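/- Let $n\ge 0$ be an integer and let $G$ be a real-valued function. Define the Bernoulli polynomials $B_m$ and the Euler polynomials $E_m$ by $\frac{te^{tx}}{e^t-1}=\sum_{m\ge0}B_m(x)\frac{t^m}{m!}$ and $\frac{2e^{tx}}{e^t+1}=\sum_{m\ge0}E_m(x)\frac{t^m}{m!}$, and the splines $b_m(x)=B_m(\{x\})$, where $\{x\}$ is the fractional part of $x$, and $e_m(x)=\frac{2}{m+1}\bigl(b_{m+1}(x)-2^{m+1}b_{m+1}(x/2)\bigr)$. Let $V_a^b(g)$ denote the total variation of $g$ on $[a,b]$ (on $[a,+\infty)$ if $b=\infty$). Integrals with respect to $dG^{(n)}$ are Riemann–Stieltjes integrals, improper at $+\infty$; derivatives at the left endpoint of a half-line are one-sided. **1.** Suppose $G\in C^n[0,+\infty)$, $G^{(n)}$ has bounded variation on $[0,+\infty)$, and $G^{(k)}(x)\to0$ as $x\to+\infty$ for $0\le k\le n$. Then for every $\varepsilon>0$ and $u\ge0$ both integrals in $$l_n(\varepsilon,u)=\int_0^\infty e_n\!\left(\frac t\varepsilon\right)dG^{(n)}(t+\varepsilon u)+\int_0^1E_n(-u+ut)\,dG^{(n)}(t\varepsilon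 u)$$ exist, the series below converges, and $$\sum_{k=1}^\infty(-1)^{k-1}G(\varepsilon k+\varepsilon u)=\sum_{k=0}^n\frac{(-1)^k\varepsilon^k}{2\,k!}E_k(-u)G^{(k)}(0)+\frac{(-1)^n\varepsilon^n}{2\,n!}\,l_n(\varepsilon,u),\qquad(*)$$ $$|l_n(\varepsilon,u)|\le\sup_{0\le x\le2}|e_n(x)|\,V_{\varepsilon u}^\infty(G^{(n)})+\sup_{-u\le x\le0}|E_n(x)|\,V_0^{\varepsilon u}(G^{(n)}).$$ If, in addition, $G^{(n)}$ is absolutely continuous on $[0,+\infty)$, then for every $a>0$, $l_n(\varepsilon,u)\to0$ as $\varepsilon\to+0$ uniformly in $u\in[0,a]$. **2.** Let $q<0$ and suppose $G\in C^n[q,+\infty)$, $G^{(n)}$ has bounded variation on $[q,+\infty)$, and $G^{(k)}(x)\to0$ as $x\to+\infty$ for $0\le k\le n$. Then for all $\varepsilon>0$ and $u\le0$ with $\varepsilon u>q$ (that is, for $u<0$ and $\varepsilon\in(0,q/u)$, and for $u=0$ and $\varepsilon>0$), both integrals in $l_n(\varepsilon,u)$ exist, the series converges, $(*)$ holds, and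 $$|l_n(\varepsilon,u)|\le\sup_{0\le x\le2}|e_n(x)|\,V_{\varepsilon u}^\infty(G^{(n)})+\sup_{0\le x\le-u}|E_n(x)|\,V_{\varepsilon u}^0(G^{(n)}).$$ If, in addition, $G^{(n)}$ is absolutely continuous on $[q,+\infty)$, then for every $b<0$, $l_n(\varepsilon,u)\to0$ as $\varepsilon\to+0$ uniformly in $u\in[b,0]$. -/

import Mathlib

open Set Filter Topology

noncomputable section

/-- The Euler polynomial `E_n`, evaluated at `x`: it is `n!` times the coefficient of `t ^ n` in
the generating function `2 e^{t x} / (e^t + 1)`. -/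
def eulerFun (n : ℕ) (x : ℝ) : ℝ :=
  (n.factorial : ℝ) * PowerSeries.coeff n
    (2 * PowerSeries.rescale x (PowerSeries.exp ℝ) * (PowerSeries.exp ℝ + 1)⁻¹)

/-- The Bernoulli spline `b_n(x) = B_n({x})`. -/
def bernoulliSpline (n : ℕ) (x : ℝ) : ℝ :=
  bernoulliFun n (Int.fract x)

/-- The Euler spline `e_n(x) = 2 / (n + 1) * (b_{n+1}(x) - 2^{n+1} b_{n+1}(x / 2))`. -/
def eulerSpline (n : ℕ) (x : ℝ) : ℝ :=
  2 / ((n : ℝ) + 1) * (bernoulliSpline (n + 1) x - 2 ^ (n + 1) * bernoulliSpline (n + 1) (x / 2))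

/-- The Riemann-Stieltjes integral `∫_a^b f dg` (for `a ≤ b`) exists and equals `I`: the sums
`∑ f(ξ_i) (g(x_{i+1}) - g(x_i))` over tagged partitions `a = x_0 ≤ x_1 ≤ ... ≤ x_N = b`,
`ξ_i ∈ [x_i, x_{i+1}]`, tend to `I` as the mesh of the partition tends to zero. -/
def HasRSIntegral (f g : ℝ → ℝ) (a b I : ℝ) : Prop :=
  ∀ η > 0, ∃ δ > 0, ∀ (N : ℕ) (x ξ : ℕ → ℝ), x 0 = a → x N = b →
    (∀ i < N, x i ≤ ξ i ∧ ξ i ≤ x (i + 1) ∧ x (i + 1) - x i < δ) →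
    |∑ i ∈ Finset.range N, f (ξ i) * (g (x (i + 1)) - g (x i)) - I| < η

/-- The improper Riemann-Stieltjes integral `∫_a^∞ f dg` exists and equals `I`: the integrals over
`[a, T]` exist for all `T ≥ a`, and they tend to `I` as `T → ∞`. -/
def HasImproperRSIntegral (f g : ℝ → ℝ) (a I : ℝ) : Prop :=
  ∃ J : ℝ → ℝ, (∀ T ≥ a, HasRSIntegral f g a T (J T)) ∧ Tendsto J atTop (𝓝 I)

/-- The `k`-th derivative of a function on the half-line `[q, ∞)` (one-sided at `q`). -/
def derivOn (q : ℝ) (G : ℝ → ℝ) (k : ℕ) : ℝ → ℝ :=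
  iteratedDerivWithin k G (Ici q)

/-- The standing conditions: `G ∈ C^n[q, ∞)`, the derivative `G^{(n)}` has bounded variation on
`[q, ∞)`, and `G^{(k)}(∞) = 0` for `0 ≤ k ≤ n`. -/
structure IsAdmissible (q : ℝ) (G : ℝ → ℝ) (n : ℕ) : Prop where
  contDiffOn : ContDiffOn ℝ n G (Ici q)
  boundedVariationOn : BoundedVariationOn (derivOn q G n) (Ici q)
  tendsto_zero : ∀ k ≤ n, Tendsto (derivOn q G k) atTop (𝓝 0)

/-- `g` is absolutely continuous on every segment `[q, b]`. For a function of bounded variation on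
`[q, ∞)` this is the same as absolute continuity on the whole half-line. -/
def AbsolutelyContinuousOnHalfLine (g : ℝ → ℝ) (q : ℝ) : Prop :=
  ∀ b ≥ q, AbsolutelyContinuousOnInterval g q b

/-- Both integrals in
`l_n(ε, u) = ∫_0^∞ e_n(t / ε) dG^{(n)}(t + ε u) + ∫_0^1 E_n(-u + u t) dG^{(n)}(t ε u)`
exist, and their sum is `l`. -/
def IsEulerRemainder (q : ℝ) (G : ℝ → ℝ) (n : ℕ) (ε u l : ℝ) : Prop :=
  ∃ I₁ I₂ : ℝ,
    HasImproperRSIntegral (fun t => eulerSpline n (t / ε))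
      (fun t => derivOn q G n (t + ε * u)) 0 I₁ ∧
    HasRSIntegral (fun t => eulerFun n (-u + u * t))
      (fun t => derivOn q G n (t * ε * u)) 0 1 I₂ ∧
    l = I₁ + I₂

/-- `∑_{k=1}^∞ (-1)^{k-1} G(ε k + ε u)` converges (as the limit of its partial sums) and equals
`∑_{k=0}^n (-1)^k ε^k / (2 k!) E_k(-u) G^{(k)}(0) + (-1)^n ε^n / (2 n!) l`. -/
def EulerExpansion (q : ℝ) (G : ℝ → ℝ) (n : ℕ) (ε u l : ℝ) : Prop :=
  Tendsto (fun N : ℕ => ∑ k ∈ Finset.Icc 1 N, (-1 : ℝ) ^ (k - 1) * G (ε * k + ε * u)) atTop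
    (𝓝 (∑ k ∈ Finset.range (n + 1),
          (-1 : ℝ) ^ k * ε ^ k / (2 * (k.factorial : ℝ)) * eulerFun k (-u) * derivOn q G k 0
        + (-1 : ℝ) ^ n * ε ^ n / (2 * (n.factorial : ℝ)) * l))

/-- `sup_{x ∈ s} |f(x)|`. -/
def supAbs (f : ℝ → ℝ) (s : Set ℝ) : ℝ :=
  sSup ((fun x => |f x|) '' s)

/-- The total variation of `g` on `s`, as a real number (used where it is finite). -/
def totalVar (g : ℝ → ℝ) (s : Set ℝ) : ℝ :=
  (eVariationOn g s).toReal

end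

/-! On the half-line `x ≥ 0` the spline `e_0` equals `(-1)^⌊x⌋`: a step function with jump `2
(-1)^k` at each integer `k ≥ 1`. Integrating `e_0(t/ε)` against a continuous `G(t + εu)` over `[0,
εN]` therefore produces twice the alternating partial sum plus values of `G` at `εu` and `εN + εu`.
Since `E_0 = 1`, the second integral is `G(εu) - G(0)`, and it trades the value at `εu` for the one
at `0`. This is the expansion of order 0.

The order is raised by induction. Both families satisfy `f_{m+1}' = (m+1) f_m` (for the splines, off
the integers), so integration by parts turns each integral against `G^{(m)}` into one against
`G^{(m+1)}`. The boundary values at `εu` cancel because `e_{m+1}(0) = E_{m+1}(0)`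
(`eulerFun_apply_zero`). What remains is `E_k(-u) G^{(k)}(0)` and `e_k(N) G^{(k)}(εN + εu)`; this is
`sum_eq_expansion`. As `N → ∞` the latter terms vanish, because `e_k` is bounded and `G^{(k)}` tends
to 0. The improper integral exists by bounded variation, and the estimate of `l` is the bound of an
integral by supremum times variation.

For absolutely continuous `G^{(n)}`, its derivative is approximated in `L^1` by a `C^1` function `φ`
of compact support. Against a primitive of `φ`, one more integration by parts gains a factor `ε`.
The approximation error and the tail are controlled by variation, and the second integral by the
variation of `G^{(n)}` between `0` and `εu`. -/

/-! ### Riemann–Stieltjes integrals -/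

/-- The increments of `f` on `[a, b]` are dominated by those of `w`. -/
def IncrementsLE (f w : ℝ → ℝ) (a b : ℝ) : Prop :=
  ∀ x y, a ≤ x → x ≤ y → y ≤ b → |f y - f x| ≤ w y - w x

lemma partition_le {N : ℕ} {x ξ : ℕ → ℝ} {δ : ℝ}
    (h : ∀ i < N, x i ≤ ξ i ∧ ξ i ≤ x (i + 1) ∧ x (i + 1) - x i < δ) {i j : ℕ} (hij : i ≤ j)
    (hj : j ≤ N) : x i ≤ x j := by
  induction j, hij using Nat.le_induction with
  | base => exact le_rfl
  | succ k hk ih =>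
    have := h k (by omega)
    linarith [ih (by omega)]

/-- Both `Ψ` and `v` telescope along a partition, so errors that are small on each cell relative to
the increment of `v` add up to at most `η (v b - v a)`. Every existence proof below, except the one
for jumps, reduces to this cellwise estimate. -/
lemma HasRSIntegral.of_local {f g Ψ v : ℝ → ℝ} {a b : ℝ}
    (h : ∀ η > 0, ∃ δ > 0, ∀ x ξ y, a ≤ x → x ≤ ξ → ξ ≤ y → y ≤ b → y - x < δ →
      |f ξ * (g y - g x) - (Ψ y - Ψ x)| ≤ η * (v y - v x)) :
    HasRSIntegral f g a b (Ψ b - Ψ a) := by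
  intro η hη
  obtain ⟨δ, hδ, H⟩ := h (η / (|v b - v a| + 1)) (by positivity)
  refine ⟨δ, hδ, fun N x ξ h0 hN hx => ?_⟩
  have e1 : Ψ b - Ψ a = ∑ i ∈ Finset.range N, (Ψ (x (i + 1)) - Ψ (x i)) := by
    rw [Finset.sum_range_sub (fun i => Ψ (x i)), h0, hN]
  have e2 : v b - v a = ∑ i ∈ Finset.range N, (v (x (i + 1)) - v (x i)) := by
    rw [Finset.sum_range_sub (fun i => v (x i)), h0, hN]
  rw [e1, ← Finset.sum_sub_distrib]
  calc _ ≤ ∑ i ∈ Finset.range N, |f (ξ i) * (g (x (i + 1)) - g (x i))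
        - (Ψ (x (i + 1)) - Ψ (x i))| := Finset.abs_sum_le_sum_abs _ _
    _ ≤ ∑ i ∈ Finset.range N, η / (|v b - v a| + 1) * (v (x (i + 1)) - v (x i)) := by
        refine Finset.sum_le_sum fun i hi => ?_
        have hi := Finset.mem_range.1 hi
        have := hx i hi
        have m0 := partition_le hx (Nat.zero_le i) hi.le
        have m1 := partition_le hx (Nat.succ_le_of_lt hi) le_rfl
        exact H _ _ _ (by rw [← h0]; exact m0) this.1 this.2.1 (by rw [← hN]; exact m1) this.2.2
    _ = η / (|v b - v a| + 1) * (v b - v a) := by rw [← Finset.mul_sum, ← e2]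
    _ ≤ η / (|v b - v a| + 1) * |v b - v a| := by gcongr; exact le_abs_self _
    _ < η := by
        rw [div_mul_eq_mul_div, div_lt_iff₀ (by positivity)]
        nlinarith

lemma HasRSIntegral.congr_left {f f' g : ℝ → ℝ} {a b I : ℝ} (h : HasRSIntegral f g a b I)
    (hf : ∀ x, a ≤ x → x ≤ b → f x = f' x) : HasRSIntegral f' g a b I := by
  intro η hη
  obtain ⟨δ, hδ, H⟩ := h η hη
  refine ⟨δ, hδ, fun N x ξ h0 hN hx => ?_⟩
  rw [← Finset.sum_congr rfl fun i hi => ?_]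
  · exact H N x ξ h0 hN hx
  have hi := Finset.mem_range.1 hi
  have := hx i hi
  have m0 := partition_le hx (Nat.zero_le i) hi.le
  have m1 := partition_le hx (Nat.succ_le_of_lt hi) le_rfl
  rw [hf (ξ i) (by linarith) (by linarith)]

lemma HasRSIntegral.add_left {f f' g : ℝ → ℝ} {a b I I' : ℝ} (h : HasRSIntegral f g a b I)
    (h' : HasRSIntegral f' g a b I') :
    HasRSIntegral (fun x => f x + f' x) g a b (I + I') := by
  intro η hη
  obtain ⟨δ, hδ, H⟩ := h (η / 2) (by positivity)
  obtain ⟨δ', hδ', H'⟩ := h' (η / 2) (by positivity)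
  refine ⟨min δ δ', lt_min hδ hδ', fun N x ξ h0 hN hx => ?_⟩
  have a1 := H N x ξ h0 hN fun i hi =>
    ⟨(hx i hi).1, (hx i hi).2.1, (hx i hi).2.2.trans_le (min_le_left _ _)⟩
  have a2 := H' N x ξ h0 hN fun i hi =>
    ⟨(hx i hi).1, (hx i hi).2.1, (hx i hi).2.2.trans_le (min_le_right _ _)⟩
  simp only [add_mul, Finset.sum_add_distrib]
  rw [abs_lt] at *
  constructor <;> linarith

lemma HasRSIntegral.sub_right {f g g' : ℝ → ℝ} {a b I I' : ℝ} (h : HasRSIntegral f g a b I)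
    (h' : HasRSIntegral f g' a b I') :
    HasRSIntegral f (fun x => g x - g' x) a b (I - I') := by
  intro η hη
  obtain ⟨δ, hδ, H⟩ := h (η / 2) (by positivity)
  obtain ⟨δ', hδ', H'⟩ := h' (η / 2) (by positivity)
  refine ⟨min δ δ', lt_min hδ hδ', fun N x ξ h0 hN hx => ?_⟩
  have a1 := H N x ξ h0 hN fun i hi =>
    ⟨(hx i hi).1, (hx i hi).2.1, (hx i hi).2.2.trans_le (min_le_left _ _)⟩
  have a2 := H' N x ξ h0 hN fun i hi =>
    ⟨(hx i hi).1, (hx i hi).2.1, (hx i hi).2.2.trans_le (min_le_right _ _)⟩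
  have : ∑ i ∈ Finset.range N, f (ξ i) * ((g (x (i + 1)) - g' (x (i + 1))) - (g (x i) - g' (x i)))
      = ∑ i ∈ Finset.range N, f (ξ i) * (g (x (i + 1)) - g (x i))
        - ∑ i ∈ Finset.range N, f (ξ i) * (g' (x (i + 1)) - g' (x i)) := by
    rw [← Finset.sum_sub_distrib]
    exact Finset.sum_congr rfl fun i _ => by ring
  rw [this]
  rw [abs_lt] at *
  constructor <;> linarith

lemma HasRSIntegral.const_mul {f g : ℝ → ℝ} {a b I : ℝ} (c : ℝ) (h : HasRSIntegral f g a b I) :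
    HasRSIntegral (fun x => c * f x) g a b (c * I) := by
  intro η hη
  obtain ⟨δ, hδ, H⟩ := h (η / (|c| + 1)) (by positivity)
  refine ⟨δ, hδ, fun N x ξ h0 hN hx => ?_⟩
  have := H N x ξ h0 hN hx
  simp only [mul_assoc]
  rw [← Finset.mul_sum, ← mul_sub, abs_mul]
  rw [lt_div_iff₀ (by positivity)] at this
  nlinarith [abs_nonneg (∑ i ∈ Finset.range N, f (ξ i) * (g (x (i + 1)) - g (x i)) - I)]

lemma hasRSIntegral_const (c : ℝ) (g : ℝ → ℝ) (a b : ℝ) :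
    HasRSIntegral (fun _ => c) g a b (c * (g b - g a)) := by
  have := HasRSIntegral.of_local (f := fun _ => c) (g := g) (Ψ := fun x => c * g x)
    (v := fun _ => 0) (a := a) (b := b) fun η hη => ⟨1, one_pos, fun x ξ y _ _ _ _ _ => by
      simp [mul_sub]⟩
  simpa [mul_sub] using this

lemma HasRSIntegral.sum_left {ι : Type*} {f : ι → ℝ → ℝ} {g : ℝ → ℝ} {a b : ℝ} {I : ι → ℝ}
    (s : Finset ι) (h : ∀ i ∈ s, HasRSIntegral (f i) g a b (I i)) :
    HasRSIntegral (fun x => ∑ i ∈ s, f i x) g a b (∑ i ∈ s, I i) := by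
  classical
  induction s using Finset.induction_on with
  | empty => simpa using hasRSIntegral_const 0 g a b
  | insert i s hi ih =>
    simp only [Finset.sum_insert hi]
    exact (h i (by simp)).add_left (ih fun j hj => h j (by simp [hj]))

/-- Two integrals with a common lower limit differ at most by the increment of a dominating
function. -/
lemma HasRSIntegral.abs_sub_le {f g w : ℝ → ℝ} {a S T I J M : ℝ} (haS : a ≤ S) (hST : S ≤ T)
    (hI : HasRSIntegral f g a S I) (hJ : HasRSIntegral f g a T J)
    (hf : ∀ x, S ≤ x → x ≤ T → |f x| ≤ M) (hg : IncrementsLE g w S T) :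
    |J - I| ≤ M * (w T - w S) := by
  refine le_of_forall_pos_le_add fun η hη => ?_
  obtain ⟨δ, hδ, H⟩ := hI (η / 2) (by positivity)
  obtain ⟨δ', hδ', H'⟩ := hJ (η / 2) (by positivity)
  obtain ⟨K, hK⟩ := exists_nat_gt ((S - a) / min δ δ' + (T - S) / min δ δ')
  have hm : 0 < min δ δ' := lt_min hδ hδ'
  have p1 : 0 ≤ (S - a) / min δ δ' := div_nonneg (by linarith) hm.le
  have p2 : 0 ≤ (T - S) / min δ δ' := div_nonneg (by linarith) hm.le
  have hK0 : (0 : ℝ) < K := by linarith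
  have s1 : (S - a) / K < min δ δ' := by
    rw [div_lt_iff₀ hK0, mul_comm, ← div_lt_iff₀ hm]; linarith
  have s2 : (T - S) / K < min δ δ' := by
    rw [div_lt_iff₀ hK0, mul_comm, ← div_lt_iff₀ hm]; linarith
  have q1 : 0 ≤ (S - a) / K := div_nonneg (by linarith) hK0.le
  have q2 : 0 ≤ (T - S) / K := div_nonneg (by linarith) hK0.le
  -- One partition serves both integrals: `K` equal cells on `[a, S]`, then `K` on `[S, T]`. The
  -- truncated `i - K` is 0 up to the node `K`, which is `S`. The difference of the two sums only
  -- involves the cells in `[S, T]`.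
  set x : ℕ → ℝ := fun i => a + (S - a) / K * (min i K : ℕ) + (T - S) / K * (i - K : ℕ) with hx
  have x0 : x 0 = a := by simp [hx]
  have xK : x K = S := by simp [hx]; field_simp; ring
  have x2K : x (K + K) = T := by simp [hx]; field_simp; ring
  have step1 : ∀ i < K, x (i + 1) - x i = (S - a) / K := fun i hi => by
    have h1 : min (i + 1) K = i + 1 := by omega
    have h2 : min i K = i := by omega
    have h3 : i + 1 - K = 0 := by omega
    have h4 : i - K = 0 := by omega
    simp only [hx, h1, h2, h3, h4]; push_cast; ring
  have step2 : ∀ i, K ≤ i → x (i + 1) - x i = (T - S) / K := fun i hi => by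
    have h1 : min (i + 1) K = K := by omega
    have h2 : min i K = K := by omega
    have h3 : i + 1 - K = (i - K) + 1 := by omega
    simp only [hx, h1, h2, h3]; push_cast; ring
  have xmesh : ∀ i < K + K, x i ≤ x i ∧ x i ≤ x (i + 1) ∧ x (i + 1) - x i < min δ δ' := by
    intro i _
    rcases lt_or_ge i K with h | h
    · have := step1 i h
      exact ⟨le_rfl, by linarith, by linarith⟩
    · have := step2 i h
      exact ⟨le_rfl, by linarith, by linarith⟩
  have b1 := H K x x x0 xK fun i hi =>
    have := xmesh i (by omega)
    ⟨this.1, this.2.1, this.2.2.trans_le (min_le_left _ _)⟩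
  have b2 := H' (K + K) x x x0 x2K fun i hi =>
    have := xmesh i hi
    ⟨this.1, this.2.1, this.2.2.trans_le (min_le_right _ _)⟩
  have b3 : |∑ i ∈ Finset.Ico K (K + K), f (x i) * (g (x (i + 1)) - g (x i))|
      ≤ M * (w T - w S) := by
    calc _ ≤ ∑ i ∈ Finset.Ico K (K + K), |f (x i) * (g (x (i + 1)) - g (x i))| :=
          Finset.abs_sum_le_sum_abs _ _
      _ ≤ ∑ i ∈ Finset.Ico K (K + K), M * (w (x (i + 1)) - w (x i)) := by
          refine Finset.sum_le_sum fun i hi => ?_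
          have hi := Finset.mem_Ico.1 hi
          have c1 : S ≤ x i := by rw [← xK]; exact partition_le xmesh hi.1 hi.2.le
          have c2 : x (i + 1) ≤ T := by
            rw [← x2K]; exact partition_le xmesh (Nat.succ_le_of_lt hi.2) le_rfl
          have c3 := (xmesh i hi.2).2.1
          rw [abs_mul]
          have := hf (x i) c1 (c3.trans c2)
          exact mul_le_mul this (hg _ _ c1 c3 c2) (abs_nonneg _) ((abs_nonneg _).trans this)
      _ = M * (w T - w S) := by
          rw [← Finset.mul_sum, Finset.sum_Ico_sub (fun i => w (x i)) (by omega), xK, x2K]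
  rw [Finset.sum_Ico_eq_sub _ (by omega : K ≤ K + K)] at b3
  rw [abs_lt] at b1 b2
  rw [abs_le] at b3 ⊢
  constructor <;> linarith

lemma hasRSIntegral_self (f g : ℝ → ℝ) (a : ℝ) : HasRSIntegral f g a a 0 := by
  have := (HasRSIntegral.congr_left (hasRSIntegral_const (f a) g a a)
    fun x h1 h2 => by rw [le_antisymm h2 h1] : HasRSIntegral f g a a _)
  simpa using this

lemma HasRSIntegral.abs_le {f g w : ℝ → ℝ} {a b I M : ℝ} (hab : a ≤ b)
    (hI : HasRSIntegral f g a b I) (hf : ∀ x, a ≤ x → x ≤ b → |f x| ≤ M)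
    (hg : IncrementsLE g w a b) : |I| ≤ M * (w b - w a) := by
  simpa using (hasRSIntegral_self f g a).abs_sub_le le_rfl hab hI hf hg

/-- This is the preceding comparison with `S = T = b`, where the increment of any dominating
function is zero. -/
lemma HasRSIntegral.unique {f g : ℝ → ℝ} {a b I J : ℝ} (hab : a ≤ b)
    (hI : HasRSIntegral f g a b I) (hJ : HasRSIntegral f g a b J) : I = J := by
  have := hI.abs_sub_le (w := 0) (M := |f b|) hab le_rfl hJ
    (fun x h1 h2 => by rw [le_antisymm h2 h1])
    (fun x y h1 h2 h3 => by
      have e1 : x = b := by linarith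
      have e2 : y = b := by linarith
      simp [e1, e2])
  simp only [Pi.zero_apply, sub_self, mul_zero, abs_nonpos_iff] at this
  linarith

/-- Integral of the indicator function of `[c, ∞)`. -/
lemma hasRSIntegral_indicator {g : ℝ → ℝ} {a b c : ℝ} (hac : a ≤ c) (hcb : c ≤ b)
    (hg : ContinuousOn g (Icc a b)) :
    HasRSIntegral (fun t => if c ≤ t then 1 else 0) g a b (g b - g c) := by
  intro η hη
  obtain ⟨δ, hδ, H⟩ := Metric.continuousOn_iff.1 hg c ⟨hac, hcb⟩ η hη
  refine ⟨δ, hδ, fun N x ξ h0 hN hx => ?_⟩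
  -- Either some tag has already reached `c`, and from the left node `y` of the first such cell on
  -- the sum telescopes; or none has, the sum is zero and `x m` exceeds `c` by less than one mesh.
  -- Continuity of `g` at `c` then replaces `y` by `c`.
  have key : ∀ m ≤ N,
      (c ≤ x m ∧ ∃ y ∈ Icc a b, |y - c| < δ ∧
        ∑ i ∈ Finset.range m, (if c ≤ ξ i then (1 : ℝ) else 0) * (g (x (i + 1)) - g (x i))
          = g (x m) - g y) ∨
      (x m < c + δ ∧
        ∑ i ∈ Finset.range m, (if c ≤ ξ i then (1 : ℝ) else 0) * (g (x (i + 1)) - g (x i))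
          = 0) := by
    intro m
    induction m with
    | zero => exact fun _ => Or.inr ⟨by rw [h0]; linarith, by simp⟩
    | succ m ih =>
      intro hm
      have hxm := hx m (by omega)
      have m0 : a ≤ x m := by rw [← h0]; exact partition_le hx (Nat.zero_le m) (by omega)
      have m1 : x (m + 1) ≤ b := by rw [← hN]; exact partition_le hx hm le_rfl
      rw [Finset.sum_range_succ]
      rcases ih (by omega) with ⟨h1, y, hy, hyc, hs⟩ | ⟨h1, hs⟩
      · left
        refine ⟨by linarith, y, hy, hyc, ?_⟩
        rw [hs, if_pos (by linarith)]
        ring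
      · by_cases hc : c ≤ ξ m
        · left
          refine ⟨by linarith, x m, ⟨m0, by linarith⟩, ?_, ?_⟩
          · rw [abs_lt]; constructor <;> linarith
          · rw [hs, if_pos hc]; ring
        · right
          push Not at hc
          refine ⟨by linarith, ?_⟩
          rw [hs, if_neg (not_le.2 hc)]; ring
  rcases key N le_rfl with ⟨-, y, hy, hyc, hs⟩ | ⟨h1, hs⟩
  · rw [hs, hN]
    have := H y hy hyc
    rw [Real.dist_eq, abs_sub_comm] at this
    rwa [show g b - g y - (g b - g c) = g c - g y by ring]
  · rw [hs, zero_sub, abs_neg]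
    refine H b ⟨hac.trans hcb, le_rfl⟩ ?_
    rw [hN] at h1
    rw [Real.dist_eq, abs_lt]
    constructor <;> linarith

lemma uniformContinuousOn_Icc {g : ℝ → ℝ} {a b : ℝ} (hg : ContinuousOn g (Icc a b)) {η : ℝ}
    (hη : 0 < η) : ∃ δ > 0, ∀ x ∈ Icc a b, ∀ y ∈ Icc a b, |x - y| < δ → |g x - g y| < η :=
  Metric.uniformContinuousOn_iff.1 (isCompact_Icc.uniformContinuousOn_of_continuous hg) η hη

/-- Integration by parts: integral of a function with bounded derivative. -/
lemma hasRSIntegral_of_primitive {F f φ : ℝ → ℝ} {a b M : ℝ} (hab : a ≤ b)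
    (hint : IntervalIntegrable f MeasureTheory.volume a b)
    (hF : ∀ x y, a ≤ x → x ≤ y → y ≤ b → F y - F x = ∫ t in x..y, f t)
    (hM : ∀ x, a ≤ x → x ≤ b → |f x| ≤ M) (hφ : ContinuousOn φ (Icc a b)) :
    HasRSIntegral F φ a b (F b * φ b - F a * φ a - ∫ t in a..b, f t * φ t) := by
  have sub : ∀ {x y}, a ≤ x → x ≤ y → y ≤ b → uIcc x y ⊆ uIcc a b := fun h1 h2 h3 => by
    rw [uIcc_of_le h2, uIcc_of_le hab]; exact Icc_subset_Icc h1 h3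
  have hφ' : ContinuousOn φ (uIcc a b) := by rwa [uIcc_of_le hab]
  have hint2 : IntervalIntegrable (fun t => f t * φ t) MeasureTheory.volume a b :=
    hint.mul_continuousOn hφ'
  have hM0 : 0 ≤ M := (abs_nonneg _).trans (hM a le_rfl hab)
  have := HasRSIntegral.of_local (f := F) (g := φ) (a := a) (b := b)
    (Ψ := fun x => F x * φ x - ∫ t in a..x, f t * φ t) (v := fun x => x) ?_
  · rwa [intervalIntegral.integral_same, sub_zero, show F b * φ b - (∫ t in a..b, f t * φ t) -
      F a * φ a = F b * φ b - F a * φ a - ∫ t in a..b, f t * φ t by ring] at this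
  intro η hη
  obtain ⟨δ, hδ, H⟩ := uniformContinuousOn_Icc hφ (show 0 < η / (M + 1) by positivity)
  refine ⟨δ, hδ, fun x ξ y h1 h2 h3 h4 h5 => ?_⟩
  have i1 := (hint2.mono_set (sub le_rfl h1 (h2.trans (h3.trans h4))))
  have i2 := (hint2.mono_set (sub h1 h2 (h3.trans h4)))
  have i3 := (hint2.mono_set (sub (h1.trans h2) h3 h4))
  have j2 := (hint.mono_set (sub h1 h2 (h3.trans h4)))
  have j3 := (hint.mono_set (sub (h1.trans h2) h3 h4))
  have e1 : ∫ t in a..y, f t * φ t = (∫ t in a..x, f t * φ t) + (∫ t in x..ξ, f t * φ t)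
      + ∫ t in ξ..y, f t * φ t := by
    rw [intervalIntegral.integral_add_adjacent_intervals i1 i2,
      intervalIntegral.integral_add_adjacent_intervals (i1.trans i2) i3]
  have e2 : (F ξ - F x) * φ x - ∫ t in x..ξ, f t * φ t = ∫ t in x..ξ, f t * (φ x - φ t) := by
    rw [hF x ξ h1 h2 (h3.trans h4), ← intervalIntegral.integral_mul_const,
      ← intervalIntegral.integral_sub (j2.mul_const _) i2]
    simp only [mul_sub]
  have e3 : (F y - F ξ) * φ y - ∫ t in ξ..y, f t * φ t = ∫ t in ξ..y, f t * (φ y - φ t) := by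
    rw [hF ξ y (h1.trans h2) h3 h4, ← intervalIntegral.integral_mul_const,
      ← intervalIntegral.integral_sub (j3.mul_const _) i3]
    simp only [mul_sub]
  -- Splitting the cell at its tag leaves `f` integrated against the oscillation of `φ` only, which
  -- uniform continuity makes small.
  have e4 : F ξ * (φ y - φ x) - ((F y * φ y - ∫ t in a..y, f t * φ t) -
      (F x * φ x - ∫ t in a..x, f t * φ t)) =
      -((∫ t in x..ξ, f t * (φ x - φ t)) + ∫ t in ξ..y, f t * (φ y - φ t)) := by
    rw [← e2, ← e3, e1]; ring
  have bound : ∀ z ∈ Icc x y, ∀ t ∈ Icc x y, ‖f t * (φ z - φ t)‖ ≤ η := by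
    intro z hz t ht
    have c1 := hM t (h1.trans ht.1) (ht.2.trans h4)
    have c2 := H z ⟨h1.trans hz.1, hz.2.trans h4⟩ t ⟨h1.trans ht.1, ht.2.trans h4⟩
      (by rw [abs_lt]; constructor <;> linarith [hz.1, hz.2, ht.1, ht.2])
    rw [Real.norm_eq_abs, abs_mul]
    calc |f t| * |φ z - φ t| ≤ M * (η / (M + 1)) := by gcongr
      _ ≤ η := by rw [mul_div_assoc', div_le_iff₀ (by positivity)]; nlinarith
  have n1 := intervalIntegral.norm_integral_le_of_norm_le_const (a := x) (b := ξ) (C := η)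
    (f := fun t => f t * (φ x - φ t)) fun t ht => by
      rw [uIoc_of_le h2] at ht
      exact bound x ⟨le_rfl, h2.trans h3⟩ t ⟨ht.1.le, ht.2.trans h3⟩
  have n2 := intervalIntegral.norm_integral_le_of_norm_le_const (a := ξ) (b := y) (C := η)
    (f := fun t => f t * (φ y - φ t)) fun t ht => by
      rw [uIoc_of_le h3] at ht
      exact bound y ⟨h2.trans h3, le_rfl⟩ t ⟨h2.trans ht.1.le, ht.2⟩
  rw [abs_of_nonneg (by linarith)] at n1 n2
  rw [e4, abs_neg]
  refine (abs_add_le _ _).trans ?_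
  rw [Real.norm_eq_abs] at n1 n2
  linarith

/-- The integral with respect to a continuously differentiable function. -/
lemma hasRSIntegral_of_deriv {f p p' v : ℝ → ℝ} {a b : ℝ} (hab : a ≤ b)
    (hint : IntervalIntegrable f MeasureTheory.volume a b)
    (hv : IncrementsLE f v a b)
    (hp : ∀ x ∈ Icc a b, HasDerivWithinAt p (p' x) (Icc a b) x)
    (hp' : ContinuousOn p' (Icc a b)) :
    HasRSIntegral f p a b (∫ t in a..b, f t * p' t) := by
  have sub : ∀ {x y}, a ≤ x → x ≤ y → y ≤ b → uIcc x y ⊆ uIcc a b := fun h1 h2 h3 => by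
    rw [uIcc_of_le h2, uIcc_of_le hab]; exact Icc_subset_Icc h1 h3
  have hpu : ContinuousOn p' (uIcc a b) := by rwa [uIcc_of_le hab]
  have hint2 : IntervalIntegrable (fun t => f t * p' t) MeasureTheory.volume a b :=
    hint.mul_continuousOn hpu
  obtain ⟨C, hC⟩ := isCompact_Icc.exists_bound_of_continuousOn hp'
  have hC0 : 0 ≤ C := (norm_nonneg _).trans (hC a ⟨le_rfl, hab⟩)
  have := HasRSIntegral.of_local (f := f) (g := p) (a := a) (b := b)
    (Ψ := fun x => ∫ t in a..x, f t * p' t) (v := v) ?_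
  · simpa using this
  intro η hη
  -- The error on a cell is at most `(v y - v x) * C * (y - x)`, so this mesh makes `C * (y - x) ≤
  -- η`.
  refine ⟨η / (C + 1), by positivity, fun x ξ y h1 h2 h3 h4 h5 => ?_⟩
  have hxy := h2.trans h3
  have i1 := (hint2.mono_set (sub le_rfl h1 (h2.trans (h3.trans h4))))
  have i2 := (hint2.mono_set (sub h1 hxy h4))
  have hc : ContinuousOn p' (Icc x y) := hp'.mono (Icc_subset_Icc h1 h4)
  have hcu : IntervalIntegrable p' MeasureTheory.volume x y :=
    ContinuousOn.intervalIntegrable (by rwa [uIcc_of_le hxy])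
  have e0 : p y - p x = ∫ t in x..y, p' t := by
    refine (intervalIntegral.integral_eq_sub_of_hasDerivAt_of_le hxy
      (fun t ht => ((hp t ⟨h1.trans ht.1, ht.2.trans h4⟩).continuousWithinAt).mono
        (Icc_subset_Icc h1 h4)) (fun t ht => ?_) hcu).symm
    exact (hp t ⟨h1.trans ht.1.le, ht.2.le.trans h4⟩).hasDerivAt
      (Icc_mem_nhds (h1.trans_lt ht.1) (ht.2.trans_le h4))
  have e1 : f ξ * (p y - p x) - ((∫ t in a..y, f t * p' t) - ∫ t in a..x, f t * p' t)
      = ∫ t in x..y, (f ξ - f t) * p' t := by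
    rw [intervalIntegral.integral_interval_sub_left (i1.trans i2) i1, e0,
      ← intervalIntegral.integral_const_mul, ← intervalIntegral.integral_sub (hcu.const_mul _) i2]
    simp only [sub_mul]
  have hv0 : 0 ≤ v y - v x := (abs_nonneg _).trans (hv x y h1 hxy h4)
  have n1 := intervalIntegral.norm_integral_le_of_norm_le_const (a := x) (b := y)
    (C := (v y - v x) * C)
    (f := fun t => (f ξ - f t) * p' t) fun t ht => by
      rw [uIoc_of_le hxy] at ht
      have c1 := hC t ⟨h1.trans ht.1.le, ht.2.trans h4⟩
      have mono : ∀ r s, x ≤ r → r ≤ s → s ≤ y → |f s - f r| ≤ v y - v x := fun r s k1 k2 k3 => by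
        have := hv r s (h1.trans k1) k2 (k3.trans h4)
        have l1 := (abs_nonneg _).trans (hv x r h1 k1 (k2.trans (k3.trans h4)))
        have l2 := (abs_nonneg _).trans (hv s y (h1.trans (k1.trans k2)) k3 h4)
        linarith
      have c2 : |f ξ - f t| ≤ v y - v x := by
        rcases le_total t ξ with h | h
        · exact mono t ξ ht.1.le h h3
        · rw [abs_sub_comm]; exact mono ξ t h2 h ht.2
      rw [norm_mul]
      exact mul_le_mul c2 c1 (norm_nonneg _) hv0
  rw [e1]
  refine (Real.norm_eq_abs _ ▸ n1).trans ?_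
  rw [abs_of_nonneg (by linarith)]
  have : C * (y - x) ≤ η := by
    rw [lt_div_iff₀ (by positivity)] at h5
    nlinarith
  nlinarith

/-- The recursion that comes from integrating by parts. -/
lemma HasRSIntegral.parts {F f φ p v : ℝ → ℝ} {a b M α β γ I : ℝ} (hab : a ≤ b)
    (hint : IntervalIntegrable f MeasureTheory.volume a b)
    (hv : IncrementsLE f v a b)
    (hF : ∀ x y, a ≤ x → x ≤ y → y ≤ b → F y - F x = ∫ t in x..y, β * γ * f t)
    (hM : ∀ x, a ≤ x → x ≤ b → |f x| ≤ M) (hφ : ContinuousOn φ (Icc a b))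
    (hp : ∀ x ∈ Icc a b, HasDerivWithinAt p (α * γ * φ x) (Icc a b) x)
    (hI : HasRSIntegral f p a b I) :
    ∃ K, HasRSIntegral F φ a b K ∧ β * I = α * (F b * φ b - F a * φ a - K) := by
  have h1 := hasRSIntegral_of_deriv hab hint hv hp (hφ.const_mul _ |>.congr fun x _ => rfl)
  have h2 := hasRSIntegral_of_primitive (M := |β * γ| * M) hab (hint.const_mul (β * γ)) hF
    (fun x k1 k2 => by rw [abs_mul]; gcongr; exact hM x k1 k2) hφ
  refine ⟨_, h2, ?_⟩
  rw [HasRSIntegral.unique hab hI h1]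
  -- The common factor `γ` will be `u` in the second integral. It may vanish, so it is carried along
  -- on both sides and never divided out.
  have e1 : ∀ t, f t * (α * γ * φ t) = (α * γ) * (f t * φ t) := fun t => by ring
  have e2 : ∀ t, β * γ * f t * φ t = (β * γ) * (f t * φ t) := fun t => by ring
  simp only [e1, e2, intervalIntegral.integral_const_mul]
  ring

/-! ### Euler polynomials -/

lemma eulerFun_eq_sum (n : ℕ) (x : ℝ) :
    eulerFun n x = n.factorial * ∑ i ∈ Finset.range (n + 1), x ^ i / i.factorial *
      PowerSeries.coeff (n - i) (2 * (PowerSeries.exp ℝ + 1)⁻¹) := by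
  rw [eulerFun, show (2 * PowerSeries.rescale x (PowerSeries.exp ℝ) * (PowerSeries.exp ℝ + 1)⁻¹)
    = PowerSeries.rescale x (PowerSeries.exp ℝ) * (2 * (PowerSeries.exp ℝ + 1)⁻¹) by ring,
    PowerSeries.coeff_mul, Finset.Nat.sum_antidiagonal_eq_sum_range_succ_mk]
  simp [PowerSeries.coeff_rescale, PowerSeries.coeff_exp, div_eq_mul_inv]

lemma exp_add_one_mul_inv :
    (PowerSeries.exp ℝ + 1) * (PowerSeries.exp ℝ + 1)⁻¹ = 1 :=
  PowerSeries.mul_inv_cancel _ (by simp)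

lemma two_eq_C : (2 : PowerSeries ℝ) = PowerSeries.C (2 : ℝ) :=
  (map_ofNat PowerSeries.C 2).symm

lemma eulerFun_zero (x : ℝ) : eulerFun 0 x = 1 := by
  have h := congrArg PowerSeries.constantCoeff exp_add_one_mul_inv
  simp only [map_mul, map_add, map_one, PowerSeries.constantCoeff_exp] at h
  rw [eulerFun_eq_sum, two_eq_C, zero_add, Finset.sum_range_one, Nat.sub_zero,
    PowerSeries.coeff_C_mul, PowerSeries.coeff_zero_eq_constantCoeff_apply]
  simp only [Nat.factorial_zero, Nat.cast_one, pow_zero, div_one, one_mul]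
  linarith

lemma hasDerivAt_eulerFun (n : ℕ) (x : ℝ) :
    HasDerivAt (eulerFun (n + 1)) ((n + 1) * eulerFun n x) x := by
  have h : eulerFun (n + 1) = fun y : ℝ => ((n + 1).factorial : ℝ) *
      ∑ i ∈ Finset.range (n + 2), y ^ i / i.factorial *
        PowerSeries.coeff (n + 1 - i) (2 * (PowerSeries.exp ℝ + 1)⁻¹) :=
    funext fun y => eulerFun_eq_sum (n + 1) y
  rw [h]
  have hd : HasDerivAt (fun y : ℝ => ((n + 1).factorial : ℝ) *
      ∑ i ∈ Finset.range (n + 2), y ^ i / i.factorial *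
        PowerSeries.coeff (n + 1 - i) (2 * (PowerSeries.exp ℝ + 1)⁻¹))
      (((n + 1).factorial : ℝ) * ∑ i ∈ Finset.range (n + 2), (i * x ^ (i - 1)) / i.factorial *
        PowerSeries.coeff (n + 1 - i) (2 * (PowerSeries.exp ℝ + 1)⁻¹)) x :=
    (HasDerivAt.fun_sum fun i _ => (((hasDerivAt_pow i x).div_const _).mul_const _)).const_mul _
  convert hd using 1
  rw [eulerFun_eq_sum, Finset.sum_range_succ' _ (n + 1), ← mul_assoc]
  simp only [Nat.cast_zero, zero_mul, zero_div, add_zero, Nat.factorial_succ, Nat.cast_mul,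
    Nat.cast_succ, Nat.add_sub_cancel, Nat.add_sub_add_right]
  congr 1
  refine Finset.sum_congr rfl fun i _ => ?_
  have : (i.factorial : ℝ) ≠ 0 := by positivity
  field_simp

lemma continuous_eulerFun (n : ℕ) : Continuous (eulerFun n) := by
  cases n with
  | zero => simpa [funext eulerFun_zero] using continuous_const
  | succ n => exact continuous_iff_continuousAt.2 fun x => (hasDerivAt_eulerFun n x).continuousAt

/-! ### Euler splines -/

/-- With `B(t) = t/(e^t - 1)`, the identity `2t/(e^t + 1) = 2 (B(t) - B(2t))` holds; it is checked
after multiplication by the nonzero series `(e^t - 1)(e^t + 1)`. Rescaling by 2 accounts for the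
factor `2^{n+1}` in the spline. -/
lemma eulerFun_apply_zero (n : ℕ) : eulerFun n 0 = eulerSpline n 0 := by
  set E : PowerSeries ℝ := PowerSeries.exp ℝ
  set B : PowerSeries ℝ := bernoulliPowerSeries ℝ
  have hB : B * (E - 1) = PowerSeries.X := bernoulliPowerSeries_mul_exp_sub_one ℝ
  have hE2 : PowerSeries.rescale (2 : ℝ) E = E * E := by
    have := PowerSeries.exp_mul_exp_eq_exp_add (1 : ℝ) (1 : ℝ)
    simp only [PowerSeries.rescale_one, RingHom.id_apply] at this
    rw [show (2 : ℝ) = 1 + 1 by norm_num]; exact this.symm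
  have hB2 : PowerSeries.rescale (2 : ℝ) B * (E * E - 1) = 2 * PowerSeries.X := by
    have := congrArg (PowerSeries.rescale (2 : ℝ)) hB
    rw [map_mul, map_sub, map_one, hE2, PowerSeries.rescale_X] at this
    rw [this, two_eq_C]
  have hne : (E - 1) * (E + 1) ≠ 0 := by
    refine mul_ne_zero (fun h => ?_) (fun h => ?_)
    · rw [h, mul_zero] at hB
      exact PowerSeries.X_ne_zero hB.symm
    · have := exp_add_one_mul_inv
      rw [show PowerSeries.exp ℝ + 1 = 0 from h, zero_mul] at this
      exact zero_ne_one this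
  have key : PowerSeries.X * (2 * (E + 1)⁻¹) = 2 * (B - PowerSeries.rescale (2 : ℝ) B) := by
    refine mul_right_cancel₀ hne ?_
    have h1 : (E + 1) * (E + 1)⁻¹ = 1 := exp_add_one_mul_inv
    linear_combination (2 * PowerSeries.X * (E - 1)) * h1 - 2 * (E + 1) * hB + 2 * hB2
  have hc := congrArg (PowerSeries.coeff (n + 1)) key
  rw [PowerSeries.coeff_succ_X_mul, show (2 : PowerSeries ℝ) * (B - PowerSeries.rescale (2 : ℝ) B)
    = PowerSeries.C (2 : ℝ) * (B - PowerSeries.rescale (2 : ℝ) B) by rw [two_eq_C],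
    PowerSeries.coeff_C_mul, map_sub, PowerSeries.coeff_rescale] at hc
  rw [eulerFun_eq_sum, Finset.sum_range_succ']
  have hz : ∑ k ∈ Finset.range n, (0 : ℝ) ^ (k + 1) / (k + 1).factorial *
      PowerSeries.coeff (n - (k + 1)) (2 * (PowerSeries.exp ℝ + 1)⁻¹) = 0 :=
    Finset.sum_eq_zero fun i _ => by simp
  rw [hz, zero_add, pow_zero, Nat.factorial_zero, Nat.cast_one, div_one, one_mul, Nat.sub_zero, hc]
  simp only [eulerSpline, bernoulliSpline, zero_div, Int.fract_zero, bernoulliFun_eval_zero, B,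
    bernoulliPowerSeries, PowerSeries.coeff_mk, Nat.factorial_succ]
  have : (n.factorial : ℝ) ≠ 0 := by positivity
  have : (n : ℝ) + 1 ≠ 0 := by positivity
  simp
  field_simp

lemma bernoulliSpline_add_int (n : ℕ) (x : ℝ) (k : ℤ) :
    bernoulliSpline n (x + k) = bernoulliSpline n x := by
  simp [bernoulliSpline]

lemma eulerSpline_periodic (n : ℕ) : Function.Periodic (eulerSpline n) 2 := fun x => by
  have h1 := bernoulliSpline_add_int (n + 1) x 2
  have h2 := bernoulliSpline_add_int (n + 1) (x / 2) 1
  push_cast at h1 h2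
  rw [eulerSpline, eulerSpline, h1, show (x + 2) / 2 = x / 2 + 1 by ring, h2]

lemma exists_bernoulliSpline_bound (n : ℕ) : ∃ C, ∀ x, |bernoulliSpline n x| ≤ C := by
  obtain ⟨C, hC⟩ := (isCompact_Icc (a := (0 : ℝ)) (b := 1)).exists_bound_of_continuousOn
    (continuous_bernoulliFun n).continuousOn
  exact ⟨C, fun x => hC _ ⟨Int.fract_nonneg x, (Int.fract_lt_one x).le⟩⟩

lemma exists_eulerSpline_bound (n : ℕ) : ∃ C, ∀ x, |eulerSpline n x| ≤ C := by
  obtain ⟨C, hC⟩ := exists_bernoulliSpline_bound (n + 1)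
  refine ⟨2 / ((n : ℝ) + 1) * (C + 2 ^ (n + 1) * C), fun x => ?_⟩
  rw [eulerSpline, abs_mul, abs_of_nonneg (by positivity : (0 : ℝ) ≤ 2 / ((n : ℝ) + 1))]
  gcongr
  refine (abs_sub _ _).trans ?_
  rw [abs_mul, abs_of_nonneg (by positivity : (0 : ℝ) ≤ 2 ^ (n + 1))]
  gcongr <;> exact hC _

/-- The bound `C` is needed because the real `sSup` of a set unbounded above takes the default value
0. -/
lemma abs_le_supAbs {f : ℝ → ℝ} {s : Set ℝ} {C x : ℝ} (hC : ∀ y ∈ s, |f y| ≤ C) (hx : x ∈ s) :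
    |f x| ≤ supAbs f s :=
  le_csSup ⟨C, by rintro _ ⟨y, hy, rfl⟩; exact hC y hy⟩ ⟨x, hx, rfl⟩

lemma abs_eulerSpline_le (n : ℕ) (x : ℝ) : |eulerSpline n x| ≤ supAbs (eulerSpline n) (Icc 0 2) := by
  obtain ⟨y, hy, h⟩ := (eulerSpline_periodic n).exists_mem_Ico₀ two_pos x
  obtain ⟨C, hC⟩ := exists_eulerSpline_bound n
  rw [h]
  exact abs_le_supAbs (fun y _ => hC y) ⟨hy.1, hy.2.le⟩

lemma abs_eulerFun_le (n : ℕ) {a b x : ℝ} (hx : x ∈ Icc a b) :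
    |eulerFun n x| ≤ supAbs (eulerFun n) (Icc a b) := by
  obtain ⟨C, hC⟩ := isCompact_Icc.exists_bound_of_continuousOn (s := Icc a b)
    (continuous_eulerFun n).continuousOn
  exact abs_le_supAbs hC hx

lemma measurable_eulerSpline (n : ℕ) : Measurable (eulerSpline n) := by
  have h : Measurable (bernoulliSpline (n + 1)) :=
    (continuous_bernoulliFun (n + 1)).measurable.comp measurable_fract
  exact (h.sub ((h.comp (measurable_id.div_const 2)).const_mul _)).const_mul _

lemma intervalIntegrable_of_bounded {f : ℝ → ℝ} (hf : Measurable f) {C : ℝ}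
    (hC : ∀ x, |f x| ≤ C) (a b : ℝ) : IntervalIntegrable f MeasureTheory.volume a b := by
  refine (intervalIntegrable_const (c := C)).mono_fun hf.aestronglyMeasurable ?_
  exact Eventually.of_forall fun x => (hC x).trans (le_abs_self C)

/-- The values `B_n(0)` and `B_n(1)` agree except for `n = 1`, where the spline jumps at the
integers. -/
lemma continuous_bernoulliSpline {n : ℕ} (hn : n ≠ 1) : Continuous (bernoulliSpline n) :=
  (continuous_bernoulliFun n).continuousOn.comp_fract''
    (bernoulliFun_endpoints_eq_of_ne_one hn).symm

lemma hasDerivAt_bernoulliSpline (n : ℕ) {x : ℝ} (hx : x ∉ range ((↑) : ℤ → ℝ)) :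
    HasDerivAt (bernoulliSpline (n + 1)) ((n + 1) * bernoulliSpline n x) x := by
  have h1 : HasDerivAt (fun y : ℝ => bernoulliFun (n + 1) (y - ⌊x⌋))
      ((n + 1) * bernoulliFun n (x - ⌊x⌋)) x := by
    have := (hasDerivAt_bernoulliFun (n + 1) (x - ⌊x⌋)).comp_sub_const x (⌊x⌋ : ℝ)
    simpa using this
  refine h1.congr_of_eventuallyEq ?_
  have hlt : (⌊x⌋ : ℝ) < x := lt_of_le_of_ne (Int.floor_le x) fun h => hx ⟨_, h⟩
  filter_upwards [Ioo_mem_nhds hlt (Int.lt_floor_add_one x)] with y hy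
  have : ⌊y⌋ = ⌊x⌋ := Int.floor_eq_iff.2 ⟨hy.1.le, hy.2⟩
  rw [bernoulliSpline, Int.fract, this]

lemma hasDerivAt_eulerSpline (n : ℕ) {x : ℝ} (hx : x ∉ range ((↑) : ℤ → ℝ)) :
    HasDerivAt (eulerSpline (n + 1)) ((n + 1) * eulerSpline n x) x := by
  have hx2 : x / 2 ∉ range ((↑) : ℤ → ℝ) := by
    rintro ⟨k, hk⟩
    exact hx ⟨2 * k, by push_cast; linarith⟩
  have h1 := hasDerivAt_bernoulliSpline (n + 1) hx
  have h2 := (hasDerivAt_bernoulliSpline (n + 1) hx2).comp x ((hasDerivAt_id x).div_const 2)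
  have := (h1.sub (h2.const_mul (2 ^ (n + 1 + 1)))).const_mul (2 / (((n + 1 : ℕ) : ℝ) + 1))
  refine HasDerivAt.congr_deriv (f := eulerSpline (n + 1)) this ?_
  rw [eulerSpline]
  push_cast
  have h3 : (n : ℝ) + 1 ≠ 0 := by positivity
  have h4 : (n : ℝ) + 1 + 1 ≠ 0 := by positivity
  field_simp
  ring

lemma continuous_eulerSpline (n : ℕ) : Continuous (eulerSpline (n + 1)) := by
  have h := continuous_bernoulliSpline (show n + 1 + 1 ≠ 1 by omega)
  unfold eulerSpline
  fun_prop

/-- The spline of order `n + 1` is continuous and differentiable off the countable set of integers,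
which is enough for the fundamental theorem even when `n = 0` and the integrand jumps. -/
lemma eulerSpline_primitive (n : ℕ) (x y : ℝ) :
    eulerSpline (n + 1) y - eulerSpline (n + 1) x = ∫ t in x..y, ((n : ℝ) + 1) * eulerSpline n t := by
  obtain ⟨C, hC⟩ := exists_eulerSpline_bound n
  exact (MeasureTheory.integral_eq_of_hasDerivAt_off_countable _ _ (countable_range _)
    (continuous_eulerSpline n).continuousOn (fun t ht => hasDerivAt_eulerSpline n ht.2)
    ((intervalIntegrable_of_bounded (measurable_eulerSpline n) hC x y).const_mul _)).symm

lemma eulerSpline_zero (x : ℝ) : eulerSpline 0 x = 1 - 2 * ⌊x⌋ + 4 * ⌊x / 2⌋ := by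
  simp only [eulerSpline, bernoulliSpline, zero_add, bernoulliFun_one, Int.fract, Nat.cast_zero, pow_one]
  ring

lemma eulerSpline_zero_of_nonneg {x : ℝ} (hx : 0 ≤ x) : eulerSpline 0 x = (-1) ^ ⌊x⌋₊ := by
  rw [eulerSpline_zero]
  have h1 : (⌊x⌋ : ℝ) = (⌊x⌋₊ : ℝ) := by
    rw [← natCast_floor_eq_intCast_floor hx]
  have h2 : (⌊x / 2⌋ : ℝ) = ((⌊x⌋₊ / 2 : ℕ) : ℝ) := by
    rw [← natCast_floor_eq_intCast_floor (by positivity)]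
    have := Nat.floor_div_natCast x 2
    push_cast at this
    rw [this]
  rw [h1, h2]
  rcases Nat.even_or_odd' ⌊x⌋₊ with ⟨k, hk | hk⟩
  · rw [hk, Nat.mul_div_cancel_left _ two_pos, pow_mul]; push_cast; norm_num; ring
  · rw [hk, show (2 * k + 1) / 2 = k by omega, pow_succ, pow_mul]; push_cast; norm_num; ring

lemma two_mul_alternating_sum (K : ℕ) :
    ∑ k ∈ Finset.Icc 1 K, 2 * (-1 : ℝ) ^ k = (-1) ^ K - 1 := by
  induction K with
  | zero => simp
  | succ K ih => rw [Finset.sum_Icc_succ_top (by omega), ih]; ring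

/-- A single `K` works for all `x` in `[0, K + 1)`, since the indicators with `k > x` vanish; the
integral of `e_0` can thus be taken indicator by indicator. -/
lemma eulerSpline_zero_eq_sum {x : ℝ} (hx : 0 ≤ x) {K : ℕ} (hK : x < K + 1) :
    eulerSpline 0 x
      = 1 + ∑ k ∈ Finset.Icc 1 K, 2 * (-1 : ℝ) ^ k * (if (k : ℝ) ≤ x then 1 else 0) := by
  rw [eulerSpline_zero_of_nonneg hx]
  have h : ⌊x⌋₊ ≤ K := by
    have := (Nat.floor_lt hx (n := K + 1)).2 (by push_cast; exact hK)
    omega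
  have : ∑ k ∈ Finset.Icc 1 K, 2 * (-1 : ℝ) ^ k * (if (k : ℝ) ≤ x then 1 else 0)
      = ∑ k ∈ Finset.Icc 1 ⌊x⌋₊, 2 * (-1 : ℝ) ^ k := by
    simp only [mul_ite, mul_one, mul_zero, ← Finset.sum_filter]
    refine Finset.sum_congr ?_ fun _ _ => rfl
    ext k
    simp only [Finset.mem_filter, Finset.mem_Icc, ← Nat.le_floor_iff hx]
    omega
  rw [this, two_mul_alternating_sum]
  ring

lemma incrementsLE_of_primitive {F f : ℝ → ℝ} {a b M : ℝ}
    (hF : ∀ x y, a ≤ x → x ≤ y → y ≤ b → F y - F x = ∫ t in x..y, f t)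
    (hM : ∀ x, a ≤ x → x ≤ b → |f x| ≤ M) : IncrementsLE F (fun x => M * x) a b :=
  fun x y h1 h2 h3 => by
    rw [hF x y h1 h2 h3]
    have := intervalIntegral.norm_integral_le_of_norm_le_const (a := x) (b := y) (C := M) (f := f)
      fun t ht => by
        rw [uIoc_of_le h2] at ht
        exact hM t (h1.trans ht.1.le) (ht.2.trans h3)
    rw [abs_of_nonneg (by linarith), Real.norm_eq_abs] at this
    linarith

/-- Order 0 is a difference of monotone floor functions; higher orders are Lipschitz. The dominating
function is the one required of the integrand in `HasRSIntegral.parts`. -/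
lemma exists_incrementsLE_eulerSpline (n : ℕ) : ∃ v, ∀ a b, IncrementsLE (eulerSpline n) v a b := by
  cases n with
  | zero =>
    refine ⟨fun x => 2 * ⌊x⌋ + 4 * ⌊x / 2⌋, fun a b x y _ h2 _ => ?_⟩
    have h3 : (⌊x⌋ : ℝ) ≤ ⌊y⌋ := by exact_mod_cast Int.floor_mono h2
    have h4 : (⌊x / 2⌋ : ℝ) ≤ ⌊y / 2⌋ := by
      exact_mod_cast Int.floor_mono (by linarith : x / 2 ≤ y / 2)
    rw [eulerSpline_zero, eulerSpline_zero, abs_le]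
    constructor <;> linarith
  | succ n =>
    obtain ⟨C, hC⟩ := exists_eulerSpline_bound n
    exact ⟨_, fun a b => incrementsLE_of_primitive (M := (n + 1) * C)
      (fun x y _ _ _ => eulerSpline_primitive n x y) fun x _ _ => by
        rw [abs_mul, abs_of_nonneg (by positivity : (0 : ℝ) ≤ n + 1)]
        gcongr
        exact hC x⟩

/-! ### Functions of bounded variation as integrators -/

lemma BoundedVariationOn.incrementsLE {g : ℝ → ℝ} {a b : ℝ} (hg : BoundedVariationOn g (Icc a b)) :
    IncrementsLE g (fun x => totalVar g (Icc a x)) a b := by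
  intro x y h1 h2 h3
  have hy : BoundedVariationOn g (Icc a y) := hg.mono (Icc_subset_Icc_right h3)
  have hx : BoundedVariationOn g (Icc a x) := hy.mono (Icc_subset_Icc_right h2)
  have hxy : BoundedVariationOn g (Icc x y) := hy.mono (Icc_subset_Icc_left h1)
  have h := eVariationOn.Icc_add_Icc g (s := univ) h1 h2 (mem_univ x)
  simp only [univ_inter] at h
  have h' := congrArg ENNReal.toReal h
  rw [ENNReal.toReal_add hx hxy] at h'
  have := hxy.dist_le (right_mem_Icc.2 h2) (left_mem_Icc.2 h2)
  rw [Real.dist_eq] at this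
  simp only [totalVar]
  linarith

lemma totalVar_Icc_self (g : ℝ → ℝ) (a : ℝ) : totalVar g (Icc a a) = 0 := by
  simp [totalVar]

lemma totalVar_mono {g : ℝ → ℝ} {s t : Set ℝ} (ht : BoundedVariationOn g t) (hst : s ⊆ t) :
    totalVar g s ≤ totalVar g t :=
  ENNReal.toReal_mono ht (eVariationOn.mono g hst)

lemma HasRSIntegral.abs_le_totalVar {f g : ℝ → ℝ} {a b I M : ℝ} (hab : a ≤ b)
    (hI : HasRSIntegral f g a b I) (hf : ∀ x, a ≤ x → x ≤ b → |f x| ≤ M)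
    (hg : BoundedVariationOn g (Icc a b)) : |I| ≤ M * totalVar g (Icc a b) := by
  have h := hI.abs_le hab hf hg.incrementsLE
  rwa [totalVar_Icc_self, sub_zero] at h

lemma HasRSIntegral.abs_sub_le_totalVar {f g : ℝ → ℝ} {a S T I J M : ℝ} (haS : a ≤ S) (hST : S ≤ T)
    (hI : HasRSIntegral f g a S I) (hJ : HasRSIntegral f g a T J)
    (hf : ∀ x, |f x| ≤ M) (hg : BoundedVariationOn g (Ici S)) :
    |J - I| ≤ M * totalVar g (Ici S) := by
  have h := hI.abs_sub_le haS hST hJ (fun x _ _ => hf x) (hg.mono Icc_subset_Ici_self).incrementsLE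
  rw [totalVar_Icc_self, sub_zero] at h
  have := (abs_nonneg _).trans (hf 0)
  exact h.trans (mul_le_mul_of_nonneg_left (totalVar_mono hg Icc_subset_Ici_self) this)

lemma tendsto_totalVar_Ici {g : ℝ → ℝ} {a : ℝ} (hg : BoundedVariationOn g (Ici a)) :
    Tendsto (fun S => totalVar g (Ici S)) atTop (𝓝 0) := by
  have h := hg.tendsto_eVariationOn_Ici_zero
  rw [inf_eq_right.2 (le_principal_iff.2 (Ici_mem_atTop a))] at h
  have h2 := (ENNReal.tendsto_toReal ENNReal.zero_ne_top).comp h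
  rw [ENNReal.toReal_zero] at h2
  refine h2.congr' ?_
  filter_upwards [eventually_ge_atTop a] with S hS
  rw [Function.comp_apply, inter_eq_self_of_subset_right (Ici_subset_Ici.2 hS), totalVar]

/-- Cauchy's criterion: beyond `S` the integrals vary by at most `M` times the variation of `g` on
`[S, ∞)`, which tends to zero. -/
lemma HasImproperRSIntegral.exists_of_boundedVariationOn {f g : ℝ → ℝ} {a M : ℝ}
    (hf : ∀ x, |f x| ≤ M) (hg : BoundedVariationOn g (Ici a))
    (h : ∀ T ≥ a, ∃ J, HasRSIntegral f g a T J) :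
    ∃ I, HasImproperRSIntegral f g a I ∧ |I| ≤ M * totalVar g (Ici a) := by
  choose! J hJ using h
  have hsub : ∀ S ≥ a, ∀ T ≥ S, |J T - J S| ≤ M * totalVar g (Ici S) := fun S hS T hT =>
    (hJ S hS).abs_sub_le_totalVar hS hT (hJ T (hS.trans hT)) hf (hg.mono (Ici_subset_Ici.2 hS))
  have hlim : Tendsto (fun S => M * totalVar g (Ici S)) atTop (𝓝 0) := by
    simpa using (tendsto_totalVar_Ici hg).const_mul M
  have hc : Cauchy (map J atTop) := by
    rw [Metric.cauchy_iff]
    refine ⟨inferInstance, fun η hη => ?_⟩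
    obtain ⟨S, hS, hSa⟩ := ((hlim.eventually (gt_mem_nhds (half_pos hη))).and
      (eventually_ge_atTop a)).exists
    refine ⟨J '' Ici S, image_mem_map (Ici_mem_atTop S), ?_⟩
    rintro _ ⟨x, hx, rfl⟩ _ ⟨y, hy, rfl⟩
    have h1 := hsub S hSa x hx
    have h2 := hsub S hSa y hy
    rw [Real.dist_eq]
    rw [abs_le] at h1 h2
    rw [abs_lt]
    constructor <;> linarith
  obtain ⟨I, hI⟩ := cauchy_map_iff_exists_tendsto.1 hc
  refine ⟨I, ⟨J, hJ, hI⟩, le_of_tendsto hI.abs ?_⟩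
  filter_upwards [eventually_ge_atTop a] with T hT
  have h0 : J a = 0 := (hJ a le_rfl).unique le_rfl (hasRSIntegral_self f g a)
  simpa [h0] using hsub a le_rfl T hT

/-! ### The two integrals of the remainder -/

lemma IncrementsLE.comp {f v φ : ℝ → ℝ} {a b c d : ℝ} (h : IncrementsLE f v c d)
    (hφ : MonotoneOn φ (Icc a b)) (hm : MapsTo φ (Icc a b) (Icc c d)) :
    IncrementsLE (fun x => f (φ x)) (fun x => v (φ x)) a b := fun x y h1 h2 h3 =>
  have hx : x ∈ Icc a b := ⟨h1, h2.trans h3⟩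
  have hy : y ∈ Icc a b := ⟨h1.trans h2, h3⟩
  h _ _ (hm hx).1 (hφ hx hy h2) (hm hy).2

/-- The factor `1` is the `γ` of `HasRSIntegral.parts`. -/
lemma eulerSpline_div_primitive (m : ℕ) {ε : ℝ} (hε : 0 < ε) (x y : ℝ) :
    eulerSpline (m + 1) (y / ε) - eulerSpline (m + 1) (x / ε)
      = ∫ t in x..y, ((m : ℝ) + 1) / ε * 1 * eulerSpline m (t / ε) := by
  rw [intervalIntegral.integral_const_mul, intervalIntegral.integral_comp_div _ hε.ne',
    eulerSpline_primitive, intervalIntegral.integral_const_mul, smul_eq_mul]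
  field_simp

lemma intervalIntegrable_eulerSpline_div (m : ℕ) (ε a b : ℝ) :
    IntervalIntegrable (fun t => eulerSpline m (t / ε)) MeasureTheory.volume a b := by
  obtain ⟨C, hC⟩ := exists_eulerSpline_bound m
  exact intervalIntegrable_of_bounded ((measurable_eulerSpline m).comp (measurable_id.div_const ε))
    (fun x => hC _) a b

lemma exists_incrementsLE_eulerSpline_div (m : ℕ) {ε : ℝ} (hε : 0 < ε) (a b : ℝ) :
    ∃ v, IncrementsLE (fun t => eulerSpline m (t / ε)) v a b := by
  obtain ⟨v, hv⟩ := exists_incrementsLE_eulerSpline m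
  have hmono : Monotone fun t : ℝ => t / ε := fun x y h => by
    dsimp only; gcongr
  exact ⟨_, (hv (a / ε) (b / ε)).comp (hmono.monotoneOn _) fun x hx =>
    ⟨hmono hx.1, hmono hx.2⟩⟩

lemma hasRSIntegral_eulerSpline_zero {g : ℝ → ℝ} {ε T : ℝ} (hε : 0 < ε)
    (hg : ContinuousOn g (Icc 0 T)) {K : ℕ} (hK : ε * K ≤ T) (hK' : T < ε * (K + 1)) :
    HasRSIntegral (fun t => eulerSpline 0 (t / ε)) g 0 T
      (1 * (g T - g 0) + ∑ k ∈ Finset.Icc 1 K, 2 * (-1 : ℝ) ^ k * (g T - g (ε * k))) := by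
  have h1 := (hasRSIntegral_const 1 g 0 T).add_left (HasRSIntegral.sum_left (Finset.Icc 1 K)
    fun k hk => (hasRSIntegral_indicator (c := ε * k) (by positivity)
      (le_trans (by gcongr; exact_mod_cast (Finset.mem_Icc.1 hk).2) hK) hg).const_mul
        (2 * (-1 : ℝ) ^ k))
  refine h1.congr_left fun x hx hxT => ?_
  rw [eulerSpline_zero_eq_sum (K := K) (by positivity)
    (by rw [div_lt_iff₀ hε]; linarith)]
  simp only [le_div_iff₀ hε, mul_comm ε]

/-- Continuity of `g` suffices: the integrand is a finite combination of indicators if `m = 0`, and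
a primitive of a bounded function otherwise. -/
lemma exists_hasRSIntegral_eulerSpline (m : ℕ) {g : ℝ → ℝ} {ε T : ℝ} (hε : 0 < ε) (hT : 0 ≤ T)
    (hg : ContinuousOn g (Icc 0 T)) :
    ∃ J, HasRSIntegral (fun t => eulerSpline m (t / ε)) g 0 T J := by
  cases m with
  | zero =>
    refine ⟨_, hasRSIntegral_eulerSpline_zero hε hg (K := ⌊T / ε⌋₊) ?_ ?_⟩
    · rw [mul_comm, ← le_div_iff₀ hε]; exact Nat.floor_le (by positivity)
    · rw [mul_comm, ← div_lt_iff₀ hε]; exact Nat.lt_floor_add_one _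
  | succ m =>
    obtain ⟨C, hC⟩ := exists_eulerSpline_bound m
    exact ⟨_, hasRSIntegral_of_primitive (M := ((m : ℝ) + 1) / ε * 1 * C) hT
      ((intervalIntegrable_eulerSpline_div m ε 0 T).const_mul _)
      (fun x y _ _ _ => eulerSpline_div_primitive m hε x y)
      (fun x _ _ => by
        rw [abs_mul, abs_of_nonneg (by positivity : 0 ≤ ((m : ℝ) + 1) / ε * 1)]
        gcongr
        exact hC _) hg⟩

lemma HasRSIntegral.eulerSpline_parts {m : ℕ} {p φ : ℝ → ℝ} {ε T I : ℝ} (hε : 0 < ε) (hT : 0 ≤ T)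
    (hφ : ContinuousOn φ (Icc 0 T))
    (hp : ∀ x ∈ Icc 0 T, HasDerivWithinAt p (φ x) (Icc 0 T) x)
    (hI : HasRSIntegral (fun t => eulerSpline m (t / ε)) p 0 T I) :
    ∃ K, HasRSIntegral (fun t => eulerSpline (m + 1) (t / ε)) φ 0 T K ∧
      (m + 1) * I
        = ε * (eulerSpline (m + 1) (T / ε) * φ T - eulerSpline (m + 1) 0 * φ 0 - K) := by
  obtain ⟨C, hC⟩ := exists_eulerSpline_bound m
  obtain ⟨v, hv⟩ := exists_incrementsLE_eulerSpline_div m hε 0 T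
  obtain ⟨K, hK, h⟩ := HasRSIntegral.parts (α := 1) (β := ((m : ℝ) + 1) / ε) (γ := 1) hT
    (intervalIntegrable_eulerSpline_div m ε 0 T) hv
    (fun x y _ _ _ => eulerSpline_div_primitive m hε x y) (fun x _ _ => hC _) hφ
    (by simpa using hp) hI
  refine ⟨K, hK, ?_⟩
  rw [zero_div, one_mul] at h
  rw [← h]
  field_simp

lemma eulerFun_affine_primitive (m : ℕ) (u x y : ℝ) :
    eulerFun (m + 1) (-u + u * y) - eulerFun (m + 1) (-u + u * x)
      = ∫ t in x..y, ((m : ℝ) + 1) * u * eulerFun m (-u + u * t) := by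
  refine (intervalIntegral.integral_eq_sub_of_hasDerivAt
    (f := fun t => eulerFun (m + 1) (-u + u * t)) (fun t _ => ?_)
    (Continuous.intervalIntegrable ?_ _ _)).symm
  · have := (hasDerivAt_eulerFun m (-u + u * t)).comp t
      (((hasDerivAt_id t).const_mul u).const_add (-u))
    refine HasDerivAt.congr_deriv (f := fun t => eulerFun (m + 1) (-u + u * t)) this ?_
    ring
  · have := continuous_eulerFun m
    fun_prop

lemma exists_bound_eulerFun_affine (m : ℕ) (u : ℝ) :
    ∃ C, ∀ x : ℝ, 0 ≤ x → x ≤ 1 → |eulerFun m (-u + u * x)| ≤ C := by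
  have hc : Continuous fun x : ℝ => eulerFun m (-u + u * x) := by
    have := continuous_eulerFun m
    fun_prop
  obtain ⟨C, hC⟩ := (isCompact_Icc (a := (0 : ℝ)) (b := 1)).exists_bound_of_continuousOn
    hc.continuousOn
  exact ⟨C, fun x h0 h1 => hC x ⟨h0, h1⟩⟩

lemma intervalIntegrable_eulerFun_affine (m : ℕ) (u a b : ℝ) :
    IntervalIntegrable (fun t => eulerFun m (-u + u * t)) MeasureTheory.volume a b := by
  refine Continuous.intervalIntegrable ?_ _ _
  have := continuous_eulerFun m
  fun_prop

lemma exists_bound_smul_eulerFun_affine (m : ℕ) (u : ℝ) :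
    ∃ C, ∀ x : ℝ, 0 ≤ x → x ≤ 1 → |((m : ℝ) + 1) * u * eulerFun m (-u + u * x)| ≤ C := by
  obtain ⟨C, hC⟩ := exists_bound_eulerFun_affine m u
  exact ⟨|((m : ℝ) + 1) * u| * C, fun x h0 h1 => by rw [abs_mul]; gcongr; exact hC x h0 h1⟩

lemma exists_incrementsLE_eulerFun_affine (m : ℕ) (u : ℝ) :
    ∃ v, IncrementsLE (fun t => eulerFun m (-u + u * t)) v 0 1 := by
  cases m with
  | zero => exact ⟨0, fun x y _ _ _ => by simp [eulerFun_zero]⟩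
  | succ m =>
    obtain ⟨C, hC⟩ := exists_bound_smul_eulerFun_affine m u
    exact ⟨_, incrementsLE_of_primitive (fun x y _ _ _ => eulerFun_affine_primitive m u x y) hC⟩

lemma exists_hasRSIntegral_eulerFun (m : ℕ) {g : ℝ → ℝ} (u : ℝ) (hg : ContinuousOn g (Icc 0 1)) :
    ∃ J, HasRSIntegral (fun t => eulerFun m (-u + u * t)) g 0 1 J := by
  cases m with
  | zero => simpa only [eulerFun_zero] using ⟨_, hasRSIntegral_const 1 g 0 1⟩
  | succ m =>
    obtain ⟨C, hC⟩ := exists_bound_smul_eulerFun_affine m u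
    exact ⟨_, hasRSIntegral_of_primitive zero_le_one
      ((intervalIntegrable_eulerFun_affine m u 0 1).const_mul _)
      (fun x y _ _ _ => eulerFun_affine_primitive m u x y) hC hg⟩

lemma HasRSIntegral.eulerFun_parts {m : ℕ} {p φ : ℝ → ℝ} {ε u I : ℝ}
    (hφ : ContinuousOn φ (Icc 0 1))
    (hp : ∀ x ∈ Icc (0 : ℝ) 1, HasDerivWithinAt p (ε * u * φ x) (Icc 0 1) x)
    (hI : HasRSIntegral (fun t => eulerFun m (-u + u * t)) p 0 1 I) :
    ∃ K, HasRSIntegral (fun t => eulerFun (m + 1) (-u + u * t)) φ 0 1 K ∧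
      (m + 1) * I = ε * (eulerFun (m + 1) 0 * φ 1 - eulerFun (m + 1) (-u) * φ 0 - K) := by
  obtain ⟨C, hC⟩ := exists_bound_eulerFun_affine m u
  obtain ⟨v, hv⟩ := exists_incrementsLE_eulerFun_affine m u
  obtain ⟨K, hK, h⟩ := HasRSIntegral.parts (α := ε) (β := (m : ℝ) + 1) (γ := u) zero_le_one
    (intervalIntegrable_eulerFun_affine m u 0 1) hv
    (fun x y _ _ _ => eulerFun_affine_primitive m u x y) hC hφ hp hI
  exact ⟨K, hK, by simpa using h⟩

/-! ### The expansion -/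

lemma derivOn_zero (q : ℝ) (G : ℝ → ℝ) : derivOn q G 0 = G := iteratedDerivWithin_zero

lemma continuousOn_derivOn {q : ℝ} {G : ℝ → ℝ} {n k : ℕ} (hG : ContDiffOn ℝ n G (Ici q))
    (hk : k ≤ n) : ContinuousOn (derivOn q G k) (Ici q) :=
  hG.continuousOn_iteratedDerivWithin (by exact_mod_cast hk) (uniqueDiffOn_Ici q)

lemma hasDerivWithinAt_derivOn {q : ℝ} {G : ℝ → ℝ} {n k : ℕ} (hG : ContDiffOn ℝ n G (Ici q))
    (hk : k < n) {x : ℝ} (hx : q ≤ x) :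
    HasDerivWithinAt (derivOn q G k) (derivOn q G (k + 1) x) (Ici q) x := by
  have := (hG.differentiableOn_iteratedDerivWithin (m := k) (by exact_mod_cast hk)
    (uniqueDiffOn_Ici q) x hx).hasDerivWithinAt
  rwa [← iteratedDerivWithin_succ] at this

lemma le_mul_of_mem_Icc {q c t : ℝ} (hq : q ≤ 0) (hc : q ≤ c) (ht : t ∈ Icc (0 : ℝ) 1) :
    q ≤ t * c := by
  nlinarith [ht.1, ht.2]

section Expansion

variable {q : ℝ} {G : ℝ → ℝ} {n : ℕ} {ε u : ℝ}

lemma continuousOn_derivOn_add_const (hG : ContDiffOn ℝ n G (Ici q)) {k : ℕ} (hk : k ≤ n) {c T : ℝ}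
    (hc : q ≤ c) : ContinuousOn (fun t => derivOn q G k (t + c)) (Icc 0 T) :=
  (continuousOn_derivOn hG hk).comp (by fun_prop) fun t ht => by
    have := ht.1
    simp only [mem_Ici]; linarith

lemma continuousOn_derivOn_mul_const (hG : ContDiffOn ℝ n G (Ici q)) {k : ℕ} (hk : k ≤ n)
    (hq : q ≤ 0) (hc : q ≤ ε * u) :
    ContinuousOn (fun t => derivOn q G k (t * ε * u)) (Icc 0 1) :=
  (continuousOn_derivOn hG hk).comp (by fun_prop) fun t ht => by
    rw [mem_Ici, mul_assoc]
    exact le_mul_of_mem_Icc hq hc ht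

lemma hasDerivWithinAt_derivOn_add_const (hG : ContDiffOn ℝ n G (Ici q)) {k : ℕ} (hk : k < n)
    {c T : ℝ} (hc : q ≤ c) {x : ℝ} (hx : x ∈ Icc 0 T) :
    HasDerivWithinAt (fun t => derivOn q G k (t + c)) (derivOn q G (k + 1) (x + c)) (Icc 0 T) x := by
  have h := (hasDerivWithinAt_derivOn hG hk (x := x + c) (by linarith [hx.1])).comp x
    ((hasDerivWithinAt_id x (Icc 0 T)).add_const c) fun t ht => by
      have := ht.1
      simp only [mem_Ici, id]; linarith
  simpa using! h

lemma hasDerivWithinAt_derivOn_mul_const (hG : ContDiffOn ℝ n G (Ici q)) {k : ℕ} (hk : k < n)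
    (hq : q ≤ 0) (hc : q ≤ ε * u) {x : ℝ} (hx : x ∈ Icc (0 : ℝ) 1) :
    HasDerivWithinAt (fun t => derivOn q G k (t * ε * u)) (ε * u * derivOn q G (k + 1) (x * ε * u))
      (Icc 0 1) x := by
  have h := (hasDerivWithinAt_derivOn hG hk (x := x * ε * u)
    (by rw [mul_assoc]; exact le_mul_of_mem_Icc hq hc hx)).comp x
    (((hasDerivWithinAt_id x (Icc 0 1)).mul_const ε).mul_const u) fun t ht => by
      rw [mem_Ici, mul_assoc]
      exact le_mul_of_mem_Icc hq hc ht
  refine h.congr_deriv ?_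
  ring

lemma abs_le_supAbs_uIcc (n : ℕ) (u : ℝ) {t : ℝ} (h0 : 0 ≤ t) (h1 : t ≤ 1) :
    |eulerFun n (-u + u * t)| ≤ supAbs (eulerFun n) (uIcc (-u) 0) := by
  refine abs_eulerFun_le n (?_ : -u + u * t ∈ uIcc (-u) 0)
  rw [mem_uIcc]
  rcases le_total 0 u with h | h
  · left; constructor <;> nlinarith
  · right; constructor <;> nlinarith

/-- The expansion of a partial sum. -/
lemma sum_eq_expansion (hq : q ≤ 0) (hG : ContDiffOn ℝ n G (Ici q)) (hε : 0 < ε) (hc : q ≤ ε * u)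
    (N : ℕ) {m : ℕ} (hm : m ≤ n) {I₁ I₂ : ℝ}
    (h₁ : HasRSIntegral (fun t => eulerSpline m (t / ε))
      (fun t => derivOn q G m (t + ε * u)) 0 (ε * N) I₁)
    (h₂ : HasRSIntegral (fun t => eulerFun m (-u + u * t))
      (fun t => derivOn q G m (t * ε * u)) 0 1 I₂) :
    ∑ k ∈ Finset.Icc 1 N, (-1 : ℝ) ^ (k - 1) * G (ε * k + ε * u) =
      ∑ k ∈ Finset.range (m + 1), (-1 : ℝ) ^ k * ε ^ k / (2 * (k.factorial : ℝ)) *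
        (eulerFun k (-u) * derivOn q G k 0
          - eulerSpline k N * derivOn q G k (ε * N + ε * u))
      + (-1 : ℝ) ^ m * ε ^ m / (2 * (m.factorial : ℝ)) * (I₁ + I₂) := by
  have hT : 0 ≤ ε * N := by positivity
  induction m generalizing I₁ I₂ with
  | zero =>
    -- The upper limit `εN` is itself a jump point; its term `g T - g (εN)` is zero.
    have k₁ := hasRSIntegral_eulerSpline_zero (K := N) hε
      (continuousOn_derivOn_add_const (T := ε * N) hG hm hc) le_rfl (by nlinarith)
    rw [h₁.unique hT k₁]
    simp only [eulerFun_zero] at h₂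
    rw [h₂.unique zero_le_one (hasRSIntegral_const 1 _ 0 1)]
    simp only [mul_sub, Finset.sum_sub_distrib, ← Finset.sum_mul, two_mul_alternating_sum]
    have hs : ∑ k ∈ Finset.Icc 1 N, 2 * (-1 : ℝ) ^ k * derivOn q G 0 (ε * k + ε * u)
        = -2 * ∑ k ∈ Finset.Icc 1 N, (-1 : ℝ) ^ (k - 1) * G (ε * k + ε * u) := by
      rw [Finset.mul_sum]
      refine Finset.sum_congr rfl fun k hk => ?_
      obtain ⟨j, rfl⟩ := Nat.exists_eq_succ_of_ne_zero
        (Nat.one_le_iff_ne_zero.1 (Finset.mem_Icc.1 hk).1)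
      simp only [derivOn_zero, Nat.succ_sub_one, pow_succ]
      ring
    rw [hs]
    simp only [zero_add, Finset.sum_range_one, eulerFun_zero,
      eulerSpline_zero_of_nonneg (Nat.cast_nonneg N), Nat.floor_natCast]
    simp
    ring
  | succ m ih =>
    obtain ⟨J₁, hJ₁⟩ := exists_hasRSIntegral_eulerSpline m hε hT
      (continuousOn_derivOn_add_const hG (by omega : m ≤ n) hc)
    obtain ⟨J₂, hJ₂⟩ := exists_hasRSIntegral_eulerFun m u
      (continuousOn_derivOn_mul_const hG (by omega : m ≤ n) hq hc)
    obtain ⟨K₁, hK₁, e₁⟩ := hJ₁.eulerSpline_parts hε hT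
      (continuousOn_derivOn_add_const hG hm hc)
      (fun x hx => hasDerivWithinAt_derivOn_add_const hG hm hc hx)
    obtain ⟨K₂, hK₂, e₂⟩ := hJ₂.eulerFun_parts
      (continuousOn_derivOn_mul_const hG hm hq hc)
      (fun x hx => hasDerivWithinAt_derivOn_mul_const hG hm hq hc hx)
    rw [hK₁.unique hT h₁, mul_div_cancel_left₀ _ hε.ne', zero_add] at e₁
    rw [hK₂.unique zero_le_one h₂, eulerFun_apply_zero, one_mul, zero_mul, zero_mul] at e₂
    -- In `e₁ + e₂` the values at `εu` cancel, both now carrying the coefficient `eulerSpline (m +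
    -- 1) 0`.
    rw [ih (by omega) hJ₁ hJ₂, Finset.sum_range_succ _ (m + 1), add_assoc, add_right_inj]
    generalize derivOn q G (m + 1) (ε * N + ε * u) = d at e₁ ⊢
    have hm1 : (m : ℝ) + 1 ≠ 0 := by positivity
    have hmf : (m.factorial : ℝ) ≠ 0 := by positivity
    rw [Nat.factorial_succ]
    push_cast
    rw [pow_succ, pow_succ]
    field_simp
    linear_combination e₁ + e₂

/-- Unordered intervals cover both signs of `u` at once. The maps `t + εu` and `tεu` are monotone or
antitone, so composing with them does not increase variation. -/
lemma IsAdmissible.exists_remainder (hG : IsAdmissible q G n) (hq : q ≤ 0) (hε : 0 < ε)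
    (hc : q ≤ ε * u) :
    ∃ l, IsEulerRemainder q G n ε u l ∧ EulerExpansion q G n ε u l ∧
      |l| ≤ supAbs (eulerSpline n) (Icc 0 2) * totalVar (derivOn q G n) (Ici (ε * u)) +
        supAbs (eulerFun n) (uIcc (-u) 0) * totalVar (derivOn q G n) (uIcc 0 (ε * u)) := by
  have hcd := hG.contDiffOn
  have hb1 : BoundedVariationOn (derivOn q G n) (Ici (ε * u)) :=
    hG.boundedVariationOn.mono (Ici_subset_Ici.2 hc)
  have hb2 : BoundedVariationOn (derivOn q G n) (uIcc 0 (ε * u)) :=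
    hG.boundedVariationOn.mono fun x hx => (le_min hq hc).trans hx.1
  have hv1 : eVariationOn (fun t => derivOn q G n (t + ε * u)) (Ici 0)
      ≤ eVariationOn (derivOn q G n) (Ici (ε * u)) :=
    eVariationOn.comp_le_of_monotoneOn (t := Ici 0) (derivOn q G n) (fun t => t + ε * u)
      (fun x _ y _ h => by dsimp only; gcongr) fun t ht => by
        have : 0 ≤ t := ht
        simp only [mem_Ici]; linarith
  have hmem : MapsTo (fun t : ℝ => t * ε * u) (Icc 0 1) (uIcc 0 (ε * u)) := fun t ht => by
    simp only [mem_uIcc, mul_assoc]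
    rcases le_total 0 (ε * u) with h | h
    · left; constructor <;> nlinarith [ht.1, ht.2]
    · right; constructor <;> nlinarith [ht.1, ht.2]
  have hv2 : eVariationOn (fun t => derivOn q G n (t * ε * u)) (Icc 0 1)
      ≤ eVariationOn (derivOn q G n) (uIcc 0 (ε * u)) := by
    rcases le_total 0 (ε * u) with h | h
    · exact eVariationOn.comp_le_of_monotoneOn (derivOn q G n) (fun t : ℝ => t * ε * u)
        (fun x _ y _ hxy => by simp only [mul_assoc]; gcongr) hmem
    · exact eVariationOn.comp_le_of_antitoneOn (derivOn q G n) (fun t : ℝ => t * ε * u)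
        (fun x _ y _ hxy => by
          simp only [mul_assoc]; exact mul_le_mul_of_nonpos_right hxy h) hmem
  have hM := (abs_nonneg _).trans (abs_eulerSpline_le n 0)
  obtain ⟨I₁, hI₁, hb₁⟩ := HasImproperRSIntegral.exists_of_boundedVariationOn
    (f := fun t => eulerSpline n (t / ε)) (fun x => abs_eulerSpline_le n _)
    (ne_top_of_le_ne_top hb1 hv1) fun T hT => exists_hasRSIntegral_eulerSpline n hε hT
      (continuousOn_derivOn_add_const hcd le_rfl hc)
  obtain ⟨I₂, hI₂⟩ := exists_hasRSIntegral_eulerFun n u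
    (continuousOn_derivOn_mul_const hcd le_rfl hq hc)
  have hb₂ := hI₂.abs_le_totalVar zero_le_one (fun x h0 h1 => abs_le_supAbs_uIcc n u h0 h1)
    (ne_top_of_le_ne_top hb2 hv2)
  have hE := (abs_nonneg _).trans (abs_le_supAbs_uIcc n u zero_le_one le_rfl)
  refine ⟨I₁ + I₂, ⟨I₁, I₂, hI₁, hI₂, rfl⟩, ?_, (abs_add_le _ _).trans (add_le_add
    (hb₁.trans ?_) (hb₂.trans ?_))⟩
  · obtain ⟨J, hJ, hlim⟩ := hI₁
    have hN : Tendsto (fun N : ℕ => ε * (N : ℝ)) atTop atTop :=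
      tendsto_natCast_atTop_atTop.const_mul_atTop hε
    -- The boundary terms at `εN + εu` are a bounded spline value times a derivative tending to
    -- zero.
    have hterm : ∀ k ∈ Finset.range (n + 1), Tendsto (fun N : ℕ =>
        (-1 : ℝ) ^ k * ε ^ k / (2 * (k.factorial : ℝ)) * (eulerFun k (-u) * derivOn q G k 0
          - eulerSpline k N * derivOn q G k (ε * N + ε * u))) atTop
        (𝓝 ((-1 : ℝ) ^ k * ε ^ k / (2 * (k.factorial : ℝ)) *
          (eulerFun k (-u) * derivOn q G k 0 - 0))) := fun k hk => by
      have hD := (hG.tendsto_zero k (by have := Finset.mem_range.1 hk; omega)).comp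
        (tendsto_atTop_add_const_right _ (ε * u) hN)
      refine (tendsto_const_nhds.sub (bdd_le_mul_tendsto_zero (b := -supAbs (eulerSpline k) (Icc 0 2))
        (B := supAbs (eulerSpline k) (Icc 0 2)) ?_ ?_ hD)).const_mul _
      · exact Eventually.of_forall fun N => (abs_le.1 (abs_eulerSpline_le k N)).1
      · exact Eventually.of_forall fun N => (abs_le.1 (abs_eulerSpline_le k N)).2
    have := (tendsto_finsetSum _ hterm).add (((hlim.comp hN).add_const I₂).const_mul
      ((-1 : ℝ) ^ n * ε ^ n / (2 * (n.factorial : ℝ))))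
    simp only [sub_zero, ← mul_assoc] at this
    refine this.congr fun N => ?_
    rw [sum_eq_expansion hq hcd hε hc N le_rfl (hJ (ε * N) (by positivity : 0 ≤ ε * (N : ℝ))) hI₂]
    simp only [Function.comp_apply]
  · exact mul_le_mul_of_nonneg_left (ENNReal.toReal_mono hb1 hv1) hM
  · exact mul_le_mul_of_nonneg_left (ENNReal.toReal_mono hb2 hv2) hE

end Expansion

/-! ### The remainder for absolutely continuous derivatives -/

lemma HasImproperRSIntegral.exists_abs_sub_le {f g : ℝ → ℝ} {a S I M : ℝ}
    (h : HasImproperRSIntegral f g a I) (hf : ∀ x, |f x| ≤ M) (haS : a ≤ S)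
    (hg : BoundedVariationOn g (Ici S)) :
    ∃ J, HasRSIntegral f g a S J ∧ |I - J| ≤ M * totalVar g (Ici S) := by
  obtain ⟨J, hJ, hlim⟩ := h
  refine ⟨J S, hJ S haS, le_of_tendsto (hlim.sub_const _).abs ?_⟩
  filter_upwards [eventually_ge_atTop S] with T hT
  exact (hJ S haS).abs_sub_le_totalVar haS hT (hJ T (haS.trans hT)) hf hg

lemma IncrementsLE.comp_antitone {f v φ : ℝ → ℝ} {a b c d : ℝ} (h : IncrementsLE f v c d)
    (hφ : AntitoneOn φ (Icc a b)) (hm : MapsTo φ (Icc a b) (Icc c d)) :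
    IncrementsLE (fun x => f (φ x)) (fun x => -v (φ x)) a b := fun x y h1 h2 h3 => by
  have hx : x ∈ Icc a b := ⟨h1, h2.trans h3⟩
  have hy : y ∈ Icc a b := ⟨h1.trans h2, h3⟩
  have := h _ _ (hm hy).1 (hφ hx hy h2) (hm hx).2
  rw [abs_sub_comm] at this
  linarith

/-- Density of smooth compactly supported functions in `L^1`, applied to `h` cut off to `(a, b]`;
restricting the error to `(a, b]` only decreases it. -/
lemma exists_smooth_approx {h : ℝ → ℝ} {a b δ : ℝ} (hab : a ≤ b)
    (hh : IntervalIntegrable h MeasureTheory.volume a b) (hδ : 0 < δ) :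
    ∃ φ : ℝ → ℝ, HasCompactSupport φ ∧ ContDiff ℝ 1 φ ∧ ∫ t in a..b, |h t - φ t| ≤ δ := by
  have hi : MeasureTheory.IntegrableOn h (Ioc a b) :=
    (intervalIntegrable_iff_integrableOn_Ioc_of_le hab).1 hh
  have hm := MeasureTheory.memLp_one_iff_integrable.2 (hi.integrable_indicator measurableSet_Ioc)
  obtain ⟨φ, h1, h2, h3⟩ := hm.exist_eLpNorm_sub_le ENNReal.one_ne_top le_rfl hδ
  have hφ : MeasureTheory.Integrable φ := h2.continuous.integrable_of_hasCompactSupport h1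
  have hd := (hi.integrable_indicator measurableSet_Ioc).sub hφ
  refine ⟨φ, h1, h2.of_le (by exact_mod_cast le_top), ?_⟩
  rw [MeasureTheory.eLpNorm_one_eq_lintegral_enorm] at h3
  have h4 := ENNReal.toReal_mono ENNReal.ofReal_ne_top h3
  rw [ENNReal.toReal_ofReal hδ.le, ← MeasureTheory.integral_norm_eq_lintegral_enorm hd.1] at h4
  refine le_trans ?_ h4
  rw [intervalIntegral.integral_of_le hab]
  refine le_trans (le_of_eq ?_) (MeasureTheory.setIntegral_le_integral (s := Ioc a b) hd.norm
    (Eventually.of_forall fun x => norm_nonneg _))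
  refine MeasureTheory.setIntegral_congr_fun measurableSet_Ioc fun x hx => ?_
  simp [indicator_of_mem hx]

lemma incrementsLE_integral_abs {g h : ℝ → ℝ} {a b : ℝ}
    (hint : IntervalIntegrable h MeasureTheory.volume a b)
    (hg : ∀ x y, a ≤ x → x ≤ y → y ≤ b → g y - g x = ∫ t in x..y, h t) :
    IncrementsLE g (fun x => ∫ t in a..x, |h t|) a b := fun x y h1 h2 h3 => by
  have sub : ∀ {x y}, a ≤ x → x ≤ y → y ≤ b → uIcc x y ⊆ uIcc a b := fun h1 h2 h3 => by
    rw [uIcc_of_le h2, uIcc_of_le (h1.trans (h2.trans h3))]; exact Icc_subset_Icc h1 h3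
  rw [intervalIntegral.integral_interval_sub_left (hint.abs.mono_set (sub le_rfl (h1.trans h2) h3))
    (hint.abs.mono_set (sub le_rfl h1 (h2.trans h3))), hg x y h1 h2 h3]
  exact intervalIntegral.abs_integral_le_integral_abs h2

/-- One more integration by parts yields the factor `ε`. As `φ` and its derivative are bounded on
the whole line, `Q` depends neither on `ε` nor on the shift `c`. -/
lemma exists_abs_eulerSpline_integral_le (n : ℕ) {φ : ℝ → ℝ} (hφ : ContDiff ℝ 1 φ)
    (hs : HasCompactSupport φ) {p : ℝ → ℝ} (hp : ∀ x, HasDerivAt p (φ x) x) {T : ℝ} (hT : 0 ≤ T) :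
    ∃ Q ≥ 0, ∀ ε > 0, ∀ c, ∃ J,
      HasRSIntegral (fun t => eulerSpline n (t / ε)) (fun t => p (t + c)) 0 T J ∧ |J| ≤ ε * Q := by
  obtain ⟨C, hC⟩ := hs.exists_bound_of_continuous hφ.continuous
  have hφ' : Continuous (deriv φ) := hφ.continuous_deriv le_rfl
  obtain ⟨K, hK⟩ := hs.deriv.exists_bound_of_continuous hφ'
  obtain ⟨M, hM⟩ := exists_eulerSpline_bound (n + 1)
  have hC0 := (norm_nonneg _).trans (hC 0)
  have hK0 := (norm_nonneg _).trans (hK 0)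
  have hM0 := (abs_nonneg _).trans (hM 0)
  refine ⟨M * C + M * C + M * (K * T), by positivity, fun ε hε c => ?_⟩
  have hpc : Continuous p := continuous_iff_continuousAt.2 fun x => (hp x).continuousAt
  have hφc := hφ.continuous
  obtain ⟨J, hJ⟩ := exists_hasRSIntegral_eulerSpline n (g := fun t => p (t + c)) hε hT
    (by fun_prop)
  refine ⟨J, hJ, ?_⟩
  obtain ⟨L, hL, e⟩ := hJ.eulerSpline_parts (φ := fun t => φ (t + c)) hε hT (by fun_prop)
    fun x _ => ((hp (x + c)).comp_add_const x c).hasDerivWithinAt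
  have hinc : IncrementsLE (fun t => φ (t + c)) (fun t => K * t) 0 T :=
    incrementsLE_of_primitive (f := fun t => deriv φ (t + c)) (fun x y _ _ _ => by
      refine (intervalIntegral.integral_eq_sub_of_hasDerivAt (f := fun t => φ (t + c))
        (fun t _ => ?_) (Continuous.intervalIntegrable (by fun_prop) _ _)).symm
      exact ((hφ.differentiable one_ne_zero (t + c)).hasDerivAt).comp_add_const t c)
      fun x _ _ => hK _
  have hLb := hL.abs_le hT (fun x _ _ => hM _) hinc
  rw [mul_zero, sub_zero] at hLb
  have b1 : |eulerSpline (n + 1) (T / ε) * φ (T + c)| ≤ M * C := by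
    rw [abs_mul]; exact mul_le_mul (hM _) (hC _) (abs_nonneg _) hM0
  have b2 : |eulerSpline (n + 1) 0 * φ (0 + c)| ≤ M * C := by
    rw [abs_mul]; exact mul_le_mul (hM _) (hC _) (abs_nonneg _) hM0
  calc |J| ≤ ((n : ℝ) + 1) * |J| := by
        have : (0 : ℝ) ≤ n := Nat.cast_nonneg n
        nlinarith [abs_nonneg J]
    _ = |((n : ℝ) + 1) * J| := by rw [abs_mul, abs_of_nonneg (by positivity : (0 : ℝ) ≤ n + 1)]
    _ ≤ ε * (M * C + M * C + M * (K * T)) := by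
        rw [e, abs_mul, abs_of_pos hε]
        gcongr
        exact (abs_sub _ _).trans (add_le_add ((abs_sub _ _).trans (add_le_add b1 b2)) hLb)

/-- Four errors below `η / 4` each: the tail beyond `T`, the integral against the smooth primitive
`p`, the integral against `g - p`, and the second integral `I₂`. -/
lemma IsAdmissible.remainder_small {q : ℝ} {G : ℝ → ℝ} {n : ℕ} (hG : IsAdmissible q G n)
    (hq : q ≤ 0) (hAC : AbsolutelyContinuousOnHalfLine (derivOn q G n) q) {A η : ℝ} (hA : 0 ≤ A)
    (hη : 0 < η) :
    ∃ ε₀ > 0, ∀ ε > 0, ε < ε₀ → ∀ u, |u| ≤ A → q ≤ ε * u → ∀ l, IsEulerRemainder q G n ε u l →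
      |l| < η := by
  set g := derivOn q G n
  set M := supAbs (eulerSpline n) (Icc 0 2)
  have hM := abs_eulerSpline_le n
  have hM0 : 0 ≤ M := (abs_nonneg _).trans (hM 0)
  obtain ⟨E, hE⟩ := (isCompact_Icc (a := -A) (b := A)).exists_bound_of_continuousOn
    (continuous_eulerFun n).continuousOn
  have hE0 : 0 ≤ E := (norm_nonneg _).trans (hE 0 ⟨by linarith, hA⟩)
  obtain ⟨T₁, hT₁, hT₁0⟩ : ∃ T₁, M * totalVar g (Ici T₁) < η / 4 ∧ 0 ≤ T₁ := by
    have hlim : Tendsto (fun S => M * totalVar g (Ici S)) atTop (𝓝 0) := by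
      simpa using (tendsto_totalVar_Ici hG.boundedVariationOn).const_mul M
    exact ((hlim.eventually (gt_mem_nhds (by positivity))).and (eventually_ge_atTop 0)).exists
  -- Shifts by `εu` have size at most `A`: they keep `[T, ∞)` inside `[T₁, ∞)` and, with `B = T +
  -- A`, keep `[0, T]` below `B`.
  set T := T₁ + A
  have hT0 : 0 ≤ T := by positivity
  set B := T + A
  have hqB : q ≤ B := hq.trans (by positivity)
  have hac := hAC B hqB
  have sub : ∀ {x y}, q ≤ x → x ≤ y → y ≤ B → uIcc x y ⊆ uIcc q B := fun h1 h2 h3 => by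
    rw [uIcc_of_le h2, uIcc_of_le hqB]; exact Icc_subset_Icc h1 h3
  have hint : IntervalIntegrable (deriv g) MeasureTheory.volume q B := hac.intervalIntegrable_deriv
  have hprim : ∀ x y, q ≤ x → x ≤ y → y ≤ B → g y - g x = ∫ t in x..y, deriv g t :=
    fun x y h1 h2 h3 => ((hac.mono (sub h1 h2 h3)).integral_deriv_eq_sub).symm
  obtain ⟨φ, hφs, hφ, hφd⟩ := exists_smooth_approx hqB hint
    (show 0 < η / (4 * (M + 1)) by positivity)
  set p : ℝ → ℝ := fun x => ∫ t in (0 : ℝ)..x, φ t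
  have hφi : ∀ x y, IntervalIntegrable φ MeasureTheory.volume x y :=
    fun x y => hφ.continuous.intervalIntegrable x y
  have hp : ∀ x, HasDerivAt p (φ x) x := fun x =>
    intervalIntegral.integral_hasDerivAt_right (hφi 0 x)
      hφ.continuous.stronglyMeasurable.stronglyMeasurableAtFilter hφ.continuous.continuousAt
  obtain ⟨Q, hQ0, hQ⟩ := exists_abs_eulerSpline_integral_le n hφ hφs hp hT0
  have hdint : IntervalIntegrable (fun t => deriv g t - φ t) MeasureTheory.volume q B :=
    hint.sub (hφi q B)
  have hr : IncrementsLE (fun x => g x - p x) (fun x => ∫ t in q..x, |deriv g t - φ t|) q B :=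
    incrementsLE_integral_abs hdint fun x y h1 h2 h3 => by
      rw [intervalIntegral.integral_sub (hint.mono_set (sub h1 h2 h3)) (hφi x y),
        ← hprim x y h1 h2 h3, ← intervalIntegral.integral_interval_sub_left (hφi 0 y) (hφi 0 x)]
      ring
  set V : ℝ → ℝ := fun x => ∫ t in q..x, |deriv g t|
  have hV : IncrementsLE g V q B := incrementsLE_integral_abs hint hprim
  have hVc : ContinuousOn V (Icc q B) := by
    have := intervalIntegral.continuousOn_primitive_interval'
      (hint.abs) (left_mem_uIcc (a := q) (b := B))
    rwa [uIcc_of_le hqB] at this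
  have h0B : (0 : ℝ) ∈ Icc q B := ⟨hq, by positivity⟩
  obtain ⟨δ, hδ, hVδ⟩ := Metric.continuousOn_iff.1 hVc 0 h0B (η / (4 * (E + 1))) (by positivity)
  -- The three bounds give, in turn, `|εu| ≤ A`, `|εu| < δ` and `εQ < η / 4`.
  refine ⟨min 1 (min (δ / (A + 1)) (η / (4 * (Q + 1)))), by positivity, ?_⟩
  rintro ε hε hε₀ u hu hc _ ⟨I₁, I₂, hI₁, hI₂, rfl⟩
  obtain ⟨hε1, hε2⟩ := lt_min_iff.1 hε₀
  obtain ⟨hε2, hε3⟩ := lt_min_iff.1 hε2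
  rw [lt_div_iff₀ (by positivity)] at hε2 hε3
  have hcabs : |ε * u| ≤ ε * A := by rw [abs_mul, abs_of_pos hε]; gcongr
  have hcA : |ε * u| ≤ A := hcabs.trans (by nlinarith)
  have hcδ : |ε * u| < δ := by linarith
  obtain ⟨hcl, hcr⟩ := abs_le.1 hcA
  have hcB : ε * u ∈ Icc q B := ⟨hc, by linarith⟩
  have hvar : eVariationOn (fun t => g (t + ε * u)) (Ici T) ≤ eVariationOn g (Ici T₁) :=
    eVariationOn.comp_le_of_monotoneOn (t := Ici T) g (fun t => t + ε * u)
      (fun x _ y _ h => by dsimp only; gcongr) fun t ht => by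
        have : T ≤ t := ht
        simp only [mem_Ici]; linarith
  have hbv : BoundedVariationOn g (Ici T₁) :=
    hG.boundedVariationOn.mono (Ici_subset_Ici.2 (hq.trans hT₁0))
  obtain ⟨J, hJ, hIJ⟩ := hI₁.exists_abs_sub_le (fun x => hM _) hT0 (ne_top_of_le_ne_top hbv hvar)
  have h1 : |I₁ - J| < η / 4 := hIJ.trans_lt (lt_of_le_of_lt
    (mul_le_mul_of_nonneg_left (ENNReal.toReal_mono hbv hvar) hM0) hT₁)
  obtain ⟨P, hP, hPb⟩ := hQ ε hε (ε * u)
  have h2 : |P| < η / 4 := by nlinarith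
  have hJP := hJ.sub_right hP
  have hshift := hr.comp (φ := fun t => t + ε * u) (a := 0) (b := T)
    (fun x _ y _ h => by dsimp only; gcongr) fun t ht => by
      constructor <;> linarith [ht.1, ht.2]
  have h3 : |J - P| < η / 4 := by
    refine (hJP.abs_le hT0 (fun x _ _ => hM _) hshift).trans_lt ?_
    have i1 : 0 ≤ ∫ t in q..(0 + ε * u), |deriv g t - φ t| :=
      intervalIntegral.integral_nonneg (by linarith) fun t _ => abs_nonneg _
    have i2 : ∫ t in q..(T + ε * u), |deriv g t - φ t| ≤ ∫ t in q..B, |deriv g t - φ t| :=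
      intervalIntegral.integral_mono_interval le_rfl (by linarith) (by linarith)
        (Eventually.of_forall fun t => abs_nonneg _) hdint.abs
    calc _ ≤ M * (η / (4 * (M + 1))) := by gcongr; linarith
      _ < η / 4 := by
        rw [mul_div_assoc', div_lt_div_iff₀ (by positivity) (by positivity)]
        nlinarith
  have hEb : ∀ t : ℝ, 0 ≤ t → t ≤ 1 → |eulerFun n (-u + u * t)| ≤ E := fun t t0 t1 => by
    refine hE _ ?_
    obtain ⟨ul, ur⟩ := abs_le.1 hu
    constructor <;> nlinarith
  have hmem : MapsTo (fun t : ℝ => t * ε * u) (Icc 0 1) (Icc q B) := fun t ht => by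
    simp only [mul_assoc]
    exact ⟨le_mul_of_mem_Icc hq hc ht, by nlinarith [ht.1, ht.2, h0B.2, hcB.2]⟩
  have h4 : |I₂| ≤ E * |V (ε * u) - V 0| := by
    rcases le_total 0 (ε * u) with h | h
    · have := hI₂.abs_le zero_le_one hEb (hV.comp (φ := fun t => t * ε * u)
        (fun x _ y _ hxy => by simp only [mul_assoc]; gcongr) hmem)
      simp only [one_mul, zero_mul] at this
      exact this.trans (by gcongr; exact le_abs_self _)
    · have := hI₂.abs_le zero_le_one hEb (hV.comp_antitone (φ := fun t => t * ε * u)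
        (fun x _ y _ hxy => by
          simp only [mul_assoc]; exact mul_le_mul_of_nonpos_right hxy h) hmem)
      simp only [one_mul, zero_mul] at this
      refine this.trans ?_
      gcongr
      rw [abs_sub_comm]
      exact (le_abs_self _).trans' (by linarith)
  have h5 : |I₂| < η / 4 := by
    have := hVδ _ hcB (by rwa [Real.dist_eq, sub_zero])
    rw [Real.dist_eq, lt_div_iff₀ (by positivity)] at this
    nlinarith [abs_nonneg (V (ε * u) - V 0)]
  rw [abs_lt] at *
  constructor <;> linarith

/-! ### Assembly of the two cases, `q = 0` and `q < 0`. -/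

theorem mainTheorem6 (n : ℕ) (G : ℝ → ℝ) :
    (IsAdmissible 0 G n →
      ∃ l : ℝ → ℝ → ℝ,
        (∀ ε > 0, ∀ u ≥ 0,
          IsEulerRemainder 0 G n ε u (l ε u) ∧
          EulerExpansion 0 G n ε u (l ε u) ∧
          |l ε u| ≤
            supAbs (eulerSpline n) (Icc 0 2) * totalVar (derivOn 0 G n) (Ici (ε * u)) +
            supAbs (eulerFun n) (Icc (-u) 0) * totalVar (derivOn 0 G n) (Icc 0 (ε * u))) ∧
        (AbsolutelyContinuousOnHalfLine (derivOn 0 G n) 0 →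
          ∀ a > 0, TendstoUniformlyOn l 0 (𝓝[>] 0) (Icc 0 a))) ∧
    (∀ q < 0, IsAdmissible q G n →
      ∃ l : ℝ → ℝ → ℝ,
        (∀ ε > 0, ∀ u ≤ 0, q < ε * u →
          IsEulerRemainder q G n ε u (l ε u) ∧
          EulerExpansion q G n ε u (l ε u) ∧
          |l ε u| ≤
            supAbs (eulerSpline n) (Icc 0 2) * totalVar (derivOn q G n) (Ici (ε * u)) +
            supAbs (eulerFun n) (Icc 0 (-u)) * totalVar (derivOn q G n) (Icc (ε * u) 0)) ∧
        (AbsolutelyContinuousOnHalfLine (derivOn q G n) q →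
          ∀ b < 0, TendstoUniformlyOn l 0 (𝓝[>] 0) (Icc b 0))) := by
  have exists_l : ∀ q ≤ 0, IsAdmissible q G n → ∃ l : ℝ → ℝ → ℝ, ∀ ε > 0, ∀ u, q ≤ ε * u →
      IsEulerRemainder q G n ε u (l ε u) ∧ EulerExpansion q G n ε u (l ε u) ∧
      |l ε u| ≤ supAbs (eulerSpline n) (Icc 0 2) * totalVar (derivOn q G n) (Ici (ε * u)) +
        supAbs (eulerFun n) (uIcc (-u) 0) * totalVar (derivOn q G n) (uIcc 0 (ε * u)) := by
    intro q hq hG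
    have : ∀ ε u, ∃ l, ε > 0 → q ≤ ε * u → IsEulerRemainder q G n ε u l ∧
        EulerExpansion q G n ε u l ∧
        |l| ≤ supAbs (eulerSpline n) (Icc 0 2) * totalVar (derivOn q G n) (Ici (ε * u)) +
          supAbs (eulerFun n) (uIcc (-u) 0) * totalVar (derivOn q G n) (uIcc 0 (ε * u)) := by
      intro ε u
      by_cases h : ε > 0 ∧ q ≤ ε * u
      · obtain ⟨l, hl⟩ := hG.exists_remainder hq h.1 h.2
        exact ⟨l, fun _ _ => hl⟩
      -- Default value of `l` outside the admissible pairs `(ε, u)`.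
      · exact ⟨0, fun h1 h2 => absurd ⟨h1, h2⟩ h⟩
    choose l hl using this
    exact ⟨l, fun ε hε u hu => hl ε u hε hu⟩
  constructor
  · intro hG
    obtain ⟨l, hl⟩ := exists_l 0 le_rfl hG
    refine ⟨l, fun ε hε u hu => ?_, fun hAC a ha => ?_⟩
    · have h0 : 0 ≤ ε * u := mul_nonneg hε.le hu
      have := hl ε hε u h0
      rwa [uIcc_of_le (neg_nonpos.2 hu), uIcc_of_le h0] at this
    · rw [Metric.tendstoUniformlyOn_iff]
      intro η hη
      obtain ⟨ε₀, hε₀, H⟩ := hG.remainder_small le_rfl hAC ha.le hη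
      filter_upwards [Ioo_mem_nhdsGT hε₀] with ε hε u hu
      have h0 : 0 ≤ ε * u := mul_nonneg hε.1.le hu.1
      rw [dist_comm, Real.dist_eq, Pi.zero_apply, sub_zero]
      exact H ε hε.1 hε.2 u (by rw [abs_of_nonneg hu.1]; exact hu.2) h0 _ (hl ε hε.1 u h0).1
  · intro q hq hG
    obtain ⟨l, hl⟩ := exists_l q hq.le hG
    refine ⟨l, fun ε hε u hu hqu => ?_, fun hAC b hb => ?_⟩
    · have h0 : ε * u ≤ 0 := mul_nonpos_of_nonneg_of_nonpos hε.le hu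
      have := hl ε hε u hqu.le
      rwa [uIcc_of_ge (neg_nonneg.2 hu), uIcc_of_ge h0] at this
    · rw [Metric.tendstoUniformlyOn_iff]
      intro η hη
      obtain ⟨ε₀, hε₀, H⟩ := hG.remainder_small hq.le hAC (neg_pos.2 hb).le hη
      -- The condition `ε < q / b` means `q < εb`, hence `q ≤ εu` for every `u` in `[b, 0]`.
      filter_upwards [Ioo_mem_nhdsGT hε₀, Ioo_mem_nhdsGT (div_pos_of_neg_of_neg hq hb)]
        with ε hε hε' u hu
      have h0 : q ≤ ε * u := by
        have := (lt_div_iff_of_neg hb).1 hε'.2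
        nlinarith [hu.1, hε.1]
      rw [dist_comm, Real.dist_eq, Pi.zero_apply, sub_zero]
      exact H ε hε.1 hε.2 u (by rw [abs_of_nonpos hu.2]; linarith [hu.1]) h0 _ (hl ε hε.1 u h0).1
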